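/- Let $V$ be a complex vector space of countably infinite dimension with a nondegenerate symmetric bilinear form $\langle\cdot,\cdot\rangle$. Let $\mathfrak{gl}(\infty,\mathbb C)=V\otimes V$ be the Lie algebra of operators on $V$ spanned by the maps $x\mapsto\langle x,w\rangle v$ ($v,w\in V$), and let $\mathfrak{so}(\infty,\mathbb C)$ be its subalgebra of operators that are skew with respect to the form. For a subspace $F\subseteq V$ let $F^\perp$ be its orthogonal complement; its closure is $\overline F=F^{\perp\perp}$, and $F$ is closed if $\overline F=F$, isotropic if $F\subseteq F^\perp$. A *generalized flag* in $V$ is a set $\mathcal F$ of subspaces, totally ordered by inclusion, such that every member has an immediate predecessor or an immediate successor in $\mathcal F$, and for every nonzero $v\in V$ there is an immediate predecessor–successor pair $F'\subset F''$ in $\mathcal F$ with $v\in F''\setminus F'$. It is *semiclosed* if for each immediate predecessor–successor pair $F'\subset F''$ one has $\overline{F'}\in\{F',F''\}$. The stabilizer of $\mathcal F$ in a Lie algebra of operators consists of the operators in it that map every member of $\mathcal F$ into itself. A semiclosed generalized flag $\mathcal F$ is *self-taut* if the $\mathfrak{gl}(\infty,\mathbb C)$-stabilizer of $\mathcal F$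 maps $F^\perp$ into itself for every $F\in\mathcal F$. A Lie algebra is *locally solvable* if each of its finite subsets lies in a solvable subalgebra. A subalgebra of $\mathfrak{so}(\infty,\mathbb C)$ is *parabolic* if it contains a maximal locally solvable subalgebra of $\mathfrak{so}(\infty,\mathbb C)$. Let $\mathfrak g$ be the $\mathfrak{so}(\infty,\mathbb C)$-stabilizer of a self-taut generalized flag, and let its linear nilradical $\mathfrak m$ be the ideal of the nilpotent operators in the locally solvable radical (the sum of all locally solvable ideals) of $\mathfrak g$. A subalgebra $\mathfrak p\subseteq\mathfrak g$ is *given by infinite trace conditions* on $\mathfrak g$ if $\mathfrak m\subseteq\mathfrak p$ and $\mathfrak p$ is the joint kernel of a family of Lie algebra homomorphisms $\mathfrak g\to\mathbb C$, each of which annihilates every finite-dimensional simple ideal of $[\mathfrak g/\mathfrak m,\mathfrak g/\mathfrak m]$. **Theorem.** Let $\mathfrak p$ be a parabolic subalgebra of $\mathfrak{so}(\infty,\mathbb C)$ given by infinite trace conditions on the $\mathfrak{so}(\infty,\mathbb C)$-stabilizer of a self-taut generalized flag $\mathcal F$ in $V$. Then exactly one of the following holds: 1. $\mathcal F$ is uniquely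 determined by $\mathfrak p$, that is, $\mathcal F$ is the only self-taut generalized flag on whose $\mathfrak{so}(\infty,\mathbb C)$-stabilizer $\mathfrak p$ is given by infinite trace conditions; 2. there are exactly three self-taut generalized flags with the same $\mathfrak{so}(\infty,\mathbb C)$-stabilizer as $\mathcal F$. Case 2 occurs precisely when there exists a closed isotropic subspace $L\in\mathcal F$ with $\dim_{\mathbb C}L^\perp/L=2$. For each such $L$, there are exactly two maximal isotropic subspaces $M_1\ne M_2$ of $V$ containing $L$, and with $\mathcal T=\{F\in\mathcal F\mid F\subseteq L\text{ or }L^\perp\subseteq F\}$ the self-taut generalized flags with the same stabilizer as $\mathcal F$ are precisely $\mathcal T$, $\mathcal T\cup\{M_1\}$ and $\mathcal T\cup\{M_2\}$. -/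

import Mathlib

attribute [local instance 100] LieRing.ofAssociativeRing

namespace FinitaryFlags

section LieAlgebras

variable {L : Type*} [LieRing L] [LieAlgebra ℂ L]

/-- A Lie algebra is locally solvable if every finite subset lies in a solvable subalgebra. -/
def IsLocallySolvable (K : Type*) [LieRing K] [LieAlgebra ℂ K] : Prop :=
  ∀ s : Finset K, ∃ k : LieSubalgebra ℂ K, (s : Set K) ⊆ k ∧ LieAlgebra.IsSolvable k

/-- A Borel subalgebra of `g`: a maximal locally solvable subalgebra of `g`. -/
def IsBorel (g b : LieSubalgebra ℂ L) : Prop :=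
  Maximal (fun c : LieSubalgebra ℂ L => c ≤ g ∧ IsLocallySolvable c) b

/-- A parabolic subalgebra of `g`: a subalgebra of `g` containing a Borel subalgebra of `g`. -/
def IsParabolic (g p : LieSubalgebra ℂ L) : Prop :=
  p ≤ g ∧ ∃ b : LieSubalgebra ℂ L, IsBorel g b ∧ b ≤ p

variable (L) in
/-- The locally solvable radical: the sum of all locally solvable ideals. -/
def locallySolvableRadical : LieIdeal ℂ L :=
  sSup {I : LieIdeal ℂ L | IsLocallySolvable I}

end LieAlgebras

section TraceConditions

variable {V : Type*} [AddCommGroup V] [Module ℂ V]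

/-- The linear nilradical of a Lie algebra `g` of linear operators: the ideal of the nilpotent
operators in the locally solvable radical of `g`. (When `g` contains the Jordan components of its
elements, as stabilizers of flags do, these operators already form an ideal.) -/
def linearNilradical (g : LieSubalgebra ℂ (Module.End ℂ V)) : LieIdeal ℂ g :=
  LieSubmodule.lieSpan ℂ g
    {x : g | x ∈ locallySolvableRadical g ∧ IsNilpotent (x : Module.End ℂ V)}

/-- The Lie algebra `[g, g] / m`, where `m` is the linear nilradical of `g`, as the derived ideal
of `g / m`. -/
abbrev derivedModNilradical (g : LieSubalgebra ℂ (Module.End ℂ V)) :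
    LieIdeal ℂ (g ⧸ linearNilradical g) :=
  LieAlgebra.derivedSeries ℂ (g ⧸ linearNilradical g) 1

/-- The family `Tr` of Lie algebra homomorphisms `g → ℂ` defines `p` by trace conditions on `g`:
`p` contains the linear nilradical of `g` and is the joint kernel of `Tr`. -/
def DefinedByTraceFamily (g p : LieSubalgebra ℂ (Module.End ℂ V)) (Tr : Set (g →ₗ⁅ℂ⁆ ℂ)) : Prop :=
  p ≤ g ∧ (∀ x ∈ linearNilradical g, (x : Module.End ℂ V) ∈ p) ∧
    ∀ x : g, (x : Module.End ℂ V) ∈ p ↔ ∀ f ∈ Tr, f x = 0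

/-- `p` is defined by infinite trace conditions on `g`: it is defined by a family of trace
conditions each of which annihilates every finite-dimensional simple ideal of `[g, g] / m`. -/
def DefinedByInfiniteTraceConditions (g p : LieSubalgebra ℂ (Module.End ℂ V)) : Prop :=
  ∃ Tr : Set (g →ₗ⁅ℂ⁆ ℂ), DefinedByTraceFamily g p Tr ∧
    ∀ f ∈ Tr, ∀ I : LieIdeal ℂ (derivedModNilradical g),
      FiniteDimensional ℂ I → LieAlgebra.IsSimple ℂ I →
        ∀ (x : g) (y : derivedModNilradical g), y ∈ I →
          (y : g ⧸ linearNilradical g) = LieSubmodule.Quotient.mk x → f x = 0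

end TraceConditions

section Flags

variable {V : Type*} [AddCommGroup V] [Module ℂ V]

/-- `F' ⊂ F''` is an immediate predecessor-successor pair in the chain `𝓕`. -/
def IsImmediatePair (𝓕 : Set (Submodule ℂ V)) (F' F'' : Submodule ℂ V) : Prop :=
  F' ∈ 𝓕 ∧ F'' ∈ 𝓕 ∧ F' < F'' ∧ ∀ G ∈ 𝓕, ¬ (F' < G ∧ G < F'')

/-- A generalized flag: a chain of subspaces in which each member has an immediate predecessor or
an immediate successor, and each nonzero vector is caught by an immediate pair. -/
structure IsGeneralizedFlag (𝓕 : Set (Submodule ℂ V)) : Prop where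
  chain : IsChain (· ≤ ·) 𝓕
  pred_or_succ : ∀ F ∈ 𝓕, (∃ G, IsImmediatePair 𝓕 G F) ∨ ∃ G, IsImmediatePair 𝓕 F G
  caught : ∀ v : V, v ≠ 0 → ∃ F' F'', IsImmediatePair 𝓕 F' F'' ∧ v ∈ F'' ∧ v ∉ F'

variable (B : LinearMap.BilinForm ℂ V)

/-- The (Mackey) closure of a subspace: its double orthogonal complement. -/
def mackeyClosure (F : Submodule ℂ V) : Submodule ℂ V := B.orthogonal (B.orthogonal F)

/-- A semiclosed generalized flag. -/
structure IsSemiclosed (𝓕 : Set (Submodule ℂ V)) : Prop extends IsGeneralizedFlag 𝓕 where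
  closure_eq : ∀ F' F'', IsImmediatePair 𝓕 F' F'' → mackeyClosure B F' = F' ∨ mackeyClosure B F' = F''

/-- The operator `v ⊗ w`, that is, `x ↦ ⟨x, w⟩ v`. -/
def rankOne (v w : V) : Module.End ℂ V := (B.flip w).smulRight v

theorem rankOne_apply (v w x : V) : rankOne B v w x = B x w • v := rfl

/-- The Lie algebra `gl(∞, ℂ) = V ⊗ V` of finitary operators on `V`, with respect to the
identification of `V` with the second defining representation given by the form. -/
def glInf : LieSubalgebra ℂ (Module.End ℂ V) where
  toSubmodule := Submodule.span ℂ {X | ∃ v w : V, X = rankOne B v w}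
  lie_mem' := by
    have key : ∀ X ∈ Submodule.span ℂ {X | ∃ v w : V, X = rankOne B v w},
        ∀ Y ∈ Submodule.span ℂ {X | ∃ v w : V, X = rankOne B v w},
          X * Y ∈ Submodule.span ℂ {X | ∃ v w : V, X = rankOne B v w} := by
      intro X hX Y hY
      induction hX, hY using Submodule.span_induction₂ with
      | mem_mem X Y hX hY =>
        obtain ⟨v, w, rfl⟩ := hX
        obtain ⟨v', w', rfl⟩ := hY
        have : rankOne B v w * rankOne B v' w' = B v' w • rankOne B v w' := by
          ext x
          simp [rankOne_apply, smul_smul, mul_comm]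
        rw [this]
        exact Submodule.smul_mem _ _ (Submodule.subset_span ⟨v, w', rfl⟩)
      | zero_left Y _ => simp
      | zero_right X _ => simp
      | add_left X X' Y _ _ _ h h' => rw [add_mul]; exact add_mem h h'
      | add_right X Y Y' _ _ _ h h' => rw [mul_add]; exact add_mem h h'
      | smul_left r X Y _ _ h => rw [smul_mul_assoc]; exact Submodule.smul_mem _ _ h
      | smul_right r X Y _ _ h => rw [mul_smul_comm]; exact Submodule.smul_mem _ _ h
    intro X Y hX hY
    rw [Ring.lie_def]
    exact sub_mem (key X hX Y hY) (key Y hY X hX)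

/-- The Lie algebra `so(∞, ℂ)` of finitary operators on `V` that are skew for the form. -/
def soInf : LieSubalgebra ℂ (Module.End ℂ V) := glInf B ⊓ skewAdjointLieSubalgebra B

/-- The stabilizer in `g` of a set `𝓕` of subspaces: all operators in `g` that map each member of
`𝓕` into itself. -/
def stabilizer (g : LieSubalgebra ℂ (Module.End ℂ V)) (𝓕 : Set (Submodule ℂ V)) :
    LieSubalgebra ℂ (Module.End ℂ V) where
  carrier := {X | X ∈ g ∧ ∀ F ∈ 𝓕, ∀ v ∈ F, X v ∈ F}
  add_mem' := fun hX hY => ⟨add_mem hX.1 hY.1, fun F hF v hv =>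
    F.add_mem (hX.2 F hF v hv) (hY.2 F hF v hv)⟩
  zero_mem' := ⟨zero_mem g, fun F _ _ _ => F.zero_mem⟩
  smul_mem' := fun c _ hX => ⟨g.smul_mem c hX.1, fun F hF v hv => F.smul_mem c (hX.2 F hF v hv)⟩
  lie_mem' := fun hX hY => ⟨g.lie_mem hX.1 hY.1, fun F hF v hv =>
    F.sub_mem (hX.2 F hF _ (hY.2 F hF v hv)) (hY.2 F hF _ (hX.2 F hF v hv))⟩

/-- A self-taut generalized flag: a semiclosed generalized flag `𝓕` such that the chain of
orthogonal complements of its members is stable under the `gl(∞, ℂ)`-stabilizer of `𝓕`. -/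
structure IsSelfTaut (𝓕 : Set (Submodule ℂ V)) : Prop extends IsSemiclosed B 𝓕 where
  stable : ∀ X ∈ stabilizer (glInf B) 𝓕, ∀ F ∈ 𝓕, ∀ v ∈ B.orthogonal F, X v ∈ B.orthogonal F

/-- A subspace on which the form vanishes identically. -/
def IsIsotropic (F : Submodule ℂ V) : Prop := F ≤ B.orthogonal F

/-- `L` is a closed isotropic member of `𝓕` with `dim (Lᗮ / L) = 2`. -/
def IsExceptional (𝓕 : Set (Submodule ℂ V)) (L : Submodule ℂ V) : Prop :=
  L ∈ 𝓕 ∧ IsIsotropic B L ∧ mackeyClosure B L = L ∧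
    Module.finrank ℂ (B.orthogonal L ⧸ L.submoduleOf (B.orthogonal L)) = 2

/-- The members `F` of `𝓕` with `F ⊆ L` or `Lᗮ ⊆ F`. -/
def truncation (𝓕 : Set (Submodule ℂ V)) (L : Submodule ℂ V) : Set (Submodule ℂ V) :=
  {F | F ∈ 𝓕 ∧ (F ≤ L ∨ B.orthogonal L ≤ F)}

/-- The self-taut generalized flags on whose `so(∞, ℂ)`-stabilizer `p` is given by infinite trace
conditions. -/
def flagsOf (p : LieSubalgebra ℂ (Module.End ℂ V)) : Set (Set (Submodule ℂ V)) :=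
  {𝓖 | IsSelfTaut B 𝓖 ∧ DefinedByInfiniteTraceConditions (stabilizer (soInf B) 𝓖) p}

/-- The self-taut generalized flags with the same `so(∞, ℂ)`-stabilizer as `𝓕`. -/
def flagsWithSameStabilizer (𝓕 : Set (Submodule ℂ V)) : Set (Set (Submodule ℂ V)) :=
  {𝓖 | IsSelfTaut B 𝓖 ∧ stabilizer (soInf B) 𝓖 = stabilizer (soInf B) 𝓕}

end Flags

end FinitaryFlags

/-! A flag has to be recovered from the subspaces that `p` leaves stable. Homomorphisms to ℂ vanish
on commutators, and `p` contains the linear nilradical, so every `p`-stable subspace is stable under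
commutators of the stabilizer and under its strictly lowering operators: it is `IsWeaklyStable`.
Members of any other flag belonging to `p` are therefore weakly stable for `𝓕`, and conversely.

Self-tautness makes orthogonal complements of members cuts of the flag (`IsSelfTaut.isCut_orth`),
which supplies many operators `wedge B f y` in the stabilizer. Let a weakly stable `U` contain a
vector outside the lower member of a pair `K < H`. These wedges move that vector around until `K ≤
U`, and also `H ≤ U` if `K` is closed and not exceptional (`IsWeaklyStable.dichotomy`). The delicate
case is `Hᗮ = K`, where commutators give all of so(H/K) as soon as dim H/K is at least 3. Two flags
whose members are so placed with respect to each other coincide (`eq_of_isNearCut`).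

The one failure is an exceptional `L`: there so(Lᗮ/L) is the abelian algebra so(2), and it preserves
both isotropic lines of the plane. Hence a skew operator stabilizing `L` stabilizes both Lagrangian
subspaces over `L` (`IsHyperbolicPair.sup_stable`), and a flag may contain either one or neither.
Conversely, two incomparable weakly stable subspaces, one of them closed, force an exceptional
member in a reduced flag (`exists_isExceptional_le`). This transfers exceptionality between flags,
and comparing truncations yields exactly three. -/

namespace FinitaryFlags

/-! ### Orthogonal complements, closures and separation of vectors -/

section Orthogonals

variable {V : Type*} [AddCommGroup V] [Module ℂ V] {B : LinearMap.BilinForm ℂ V}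

theorem mem_orth {F : Submodule ℂ V} {y : V} : y ∈ B.orthogonal F ↔ ∀ x ∈ F, B x y = 0 :=
  LinearMap.BilinForm.mem_orthogonal_iff

theorem mem_orth' (hB : B.IsSymm) {F : Submodule ℂ V} {y : V} :
    y ∈ B.orthogonal F ↔ ∀ x ∈ F, B y x = 0 := by
  simp only [mem_orth, hB.eq y]

theorem orth_anti {F G : Submodule ℂ V} (h : F ≤ G) : B.orthogonal G ≤ B.orthogonal F :=
  LinearMap.BilinForm.orthogonal_le h

theorem le_orth_comm (hB : B.IsSymm) {F G : Submodule ℂ V} (h : F ≤ B.orthogonal G) :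
    G ≤ B.orthogonal F :=
  fun _ hx => (mem_orth' hB).2 fun _ hy => mem_orth.1 (h hy) _ hx

theorem le_closure (hB : B.IsSymm) (F : Submodule ℂ V) : F ≤ mackeyClosure B F :=
  le_orth_comm hB le_rfl

theorem closure_mono {F G : Submodule ℂ V} (h : F ≤ G) : mackeyClosure B F ≤ mackeyClosure B G :=
  orth_anti (orth_anti h)

theorem orth_closure (hB : B.IsSymm) (F : Submodule ℂ V) :
    B.orthogonal (mackeyClosure B F) = B.orthogonal F :=
  le_antisymm (orth_anti (le_closure hB F)) (le_closure hB _)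

theorem closure_orth (hB : B.IsSymm) (F : Submodule ℂ V) :
    mackeyClosure B (B.orthogonal F) = B.orthogonal F :=
  orth_closure hB F

theorem closure_closure (hB : B.IsSymm) (F : Submodule ℂ V) :
    mackeyClosure B (mackeyClosure B F) = mackeyClosure B F :=
  closure_orth hB _

theorem closure_le_of_closed {F G : Submodule ℂ V} (hG : mackeyClosure B G = G) (h : F ≤ G) :
    mackeyClosure B F ≤ G :=
  (closure_mono h).trans hG.le

theorem exists_orth_ne (hB : B.IsSymm) {F : Submodule ℂ V} {u : V} (hu : u ∉ mackeyClosure B F) :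
    ∃ y ∈ B.orthogonal F, B u y ≠ 0 := by
  by_contra! h
  exact hu ((mem_orth' hB).2 h)

/-- If every element of `A` orthogonal to `v` is orthogonal to `u`, then `u` agrees with a multiple
of `v` on `A`. -/
theorem exists_sub_smul_orth (hB : B.IsSymm) {A : Submodule ℂ V} {u v : V}
    (h : ∀ y ∈ A, B v y = 0 → B u y = 0) : ∃ c : ℂ, u - c • v ∈ B.orthogonal A := by
  by_cases hv : ∀ y ∈ A, B v y = 0
  · exact ⟨0, (mem_orth' hB).2 fun y hy => by simpa using h y hy (hv y hy)⟩
  · push Not at hv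
    obtain ⟨z, hz, hvz⟩ := hv
    refine ⟨B u z / B v z, (mem_orth' hB).2 fun y hy => ?_⟩
    have := h (y - (B v y / B v z) • z) (A.sub_mem hy (A.smul_mem _ hz)) (by simp [hvz])
    simp only [map_sub, map_smul, smul_eq_mul, LinearMap.sub_apply, LinearMap.smul_apply] at this ⊢
    rw [← this]
    ring

/-- Separation of `u` from `K + ℂ v` by an element of a subspace `A` with `Aᗮ = K`. -/
theorem exists_orth_and_eq_one (hB : B.IsSymm) {A K : Submodule ℂ V} (hA : B.orthogonal A ≤ K)
    {u v : V} (h : ∀ c : ℂ, u - c • v ∉ K) : ∃ y ∈ A, B v y = 0 ∧ B u y = 1 := by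
  by_contra! hy
  obtain ⟨c, hc⟩ := exists_sub_smul_orth hB (A := A) (u := u) (v := v) fun y hyA hvy => by
    by_contra huy
    exact hy ((B u y)⁻¹ • y) (A.smul_mem _ hyA) (by simp [hvy]) (by simp [huy])
  exact h c (hA hc)

theorem exists_eq_one (hB : B.IsSymm) {A K : Submodule ℂ V} (hA : B.orthogonal A ≤ K)
    {u : V} (h : u ∉ K) : ∃ y ∈ A, B u y = 1 := by
  obtain ⟨y, hy, -, h1⟩ := exists_orth_and_eq_one hB hA (u := u) (v := 0) (by simpa using h)
  exact ⟨y, hy, h1⟩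

/-- A vector `x` of the closure is orthogonal to everything in `Kᗮ` that is orthogonal to `v`, so it
agrees on `Kᗮ` with a multiple of `v`; the difference lies in `Kᗮᗮ = K`. -/
theorem closed_sup_span_singleton (hB : B.IsSymm) {K : Submodule ℂ V}
    (hK : mackeyClosure B K = K) (v : V) :
    mackeyClosure B (K ⊔ Submodule.span ℂ {v}) = K ⊔ Submodule.span ℂ {v} := by
  refine le_antisymm (fun x hx => ?_) (le_closure hB _)
  obtain ⟨c, hc⟩ := exists_sub_smul_orth hB (A := B.orthogonal K) (u := x) (v := v)
    fun y hy hvy => by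
      refine (mem_orth' hB).1 hx y ((mem_orth' hB).2 fun z hz => ?_)
      obtain ⟨k, hk, w, hw, rfl⟩ := Submodule.mem_sup.1 hz
      obtain ⟨t, rfl⟩ := Submodule.mem_span_singleton.1 hw
      have h1 := (mem_orth' hB).1 hy k hk
      rw [hB.eq] at hvy
      simp [h1, hvy]
  refine Submodule.mem_sup.2 ⟨x - c • v, hK.le hc, c • v, ?_, by simp⟩
  exact Submodule.smul_mem _ _ (Submodule.mem_span_singleton_self v)

theorem mem_sup_span_singleton_iff {K : Submodule ℂ V} {v x : V} :
    x ∈ K ⊔ Submodule.span ℂ {v} ↔ ∃ c : ℂ, x - c • v ∈ K := by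
  constructor
  · intro hx
    obtain ⟨k, hk, w, hw, rfl⟩ := Submodule.mem_sup.1 hx
    obtain ⟨t, rfl⟩ := Submodule.mem_span_singleton.1 hw
    exact ⟨t, by simpa using hk⟩
  · rintro ⟨c, hc⟩
    exact Submodule.mem_sup.2
      ⟨_, hc, c • v, Submodule.smul_mem _ _ (Submodule.mem_span_singleton_self v), by simp⟩

/-- A quotient of dimension two, in terms of representatives of a basis. -/
theorem finrank_quotient_eq_two_iff {P K : Submodule ℂ V} :
    Module.finrank ℂ (P ⧸ K.submoduleOf P) = 2 ↔
      ∃ a ∈ P, ∃ b ∈ P, (∀ s t : ℂ, s • a + t • b ∈ K → s = 0 ∧ t = 0) ∧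
        ∀ x ∈ P, ∃ s t : ℂ, x - (s • a + t • b) ∈ K := by
  constructor
  · intro h
    have : FiniteDimensional ℂ (P ⧸ K.submoduleOf P) :=
      FiniteDimensional.of_finrank_pos (by omega)
    let e := Module.finBasisOfFinrankEq ℂ _ h
    obtain ⟨a, ha⟩ := Submodule.Quotient.mk_surjective _ (e 0)
    obtain ⟨b, hb⟩ := Submodule.Quotient.mk_surjective _ (e 1)
    refine ⟨a, a.2, b, b.2, fun s t hst => ?_, fun x hx => ?_⟩
    · have h0 : s • e 0 + t • e 1 = 0 := by
        rw [← ha, ← hb, ← Submodule.Quotient.mk_smul, ← Submodule.Quotient.mk_smul,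
          ← Submodule.Quotient.mk_add, Submodule.Quotient.mk_eq_zero]
        exact hst
      have := Fintype.linearIndependent_iff.1 e.linearIndependent ![s, t]
        (by simpa [Fin.sum_univ_two] using h0)
      exact ⟨this 0, this 1⟩
    · have := e.sum_repr (Submodule.Quotient.mk ⟨x, hx⟩)
      rw [Fin.sum_univ_two, ← ha, ← hb, ← Submodule.Quotient.mk_smul,
        ← Submodule.Quotient.mk_smul, ← Submodule.Quotient.mk_add, eq_comm,
        Submodule.Quotient.eq] at this
      exact ⟨_, _, this⟩
  · rintro ⟨a, ha, b, hb, hli, hsp⟩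
    let q := (K.submoduleOf P).mkQ
    have hl : LinearIndependent ℂ ![q ⟨a, ha⟩, q ⟨b, hb⟩] := by
      rw [LinearIndependent.pair_iff]
      intro s t hst
      rw [← map_smul, ← map_smul, ← map_add, Submodule.mkQ_apply,
        Submodule.Quotient.mk_eq_zero] at hst
      exact hli s t hst
    have hs : ⊤ ≤ Submodule.span ℂ (Set.range ![q ⟨a, ha⟩, q ⟨b, hb⟩]) := by
      intro x _
      obtain ⟨⟨x, hx⟩, rfl⟩ := Submodule.mkQ_surjective _ x
      obtain ⟨s, t, hst⟩ := hsp x hx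
      rw [Matrix.range_cons, Matrix.range_cons, Matrix.range_empty, Set.union_empty,
        Set.singleton_union, Submodule.mem_span_pair]
      refine ⟨s, t, ?_⟩
      rw [← map_smul, ← map_smul, ← map_add, eq_comm]
      exact (Submodule.Quotient.eq _).2 hst
    simpa using Module.finrank_eq_card_basis (Module.Basis.mk hl hs)

end Orthogonals

/-! ### Cuts of generalized flags and self-tautness -/

section Cuts

variable {V : Type*} [AddCommGroup V] [Module ℂ V] {𝓕 : Set (Submodule ℂ V)}

/-- A subspace which no immediate pair of `𝓕` strictly straddles. -/
def IsCut (𝓕 : Set (Submodule ℂ V)) (D : Submodule ℂ V) : Prop :=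
  ∀ F' F'', IsImmediatePair 𝓕 F' F'' → D ≤ F' ∨ F'' ≤ D

theorem IsGeneralizedFlag.isCut (h : IsGeneralizedFlag 𝓕) {F : Submodule ℂ V} (hF : F ∈ 𝓕) :
    IsCut 𝓕 F := by
  intro F' F'' hp
  rcases h.chain.total hF hp.1 with h1 | h1
  · exact .inl h1
  rcases h.chain.total hF hp.2.1 with h2 | h2
  · rcases h1.lt_or_eq with h3 | h3
    · rcases h2.lt_or_eq with h4 | h4
      · exact absurd ⟨h3, h4⟩ (hp.2.2.2 F hF)
      · exact .inr h4.ge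
    · exact .inl h3.ge
  · exact .inr h2

theorem IsCut.exists_pair (h : IsGeneralizedFlag 𝓕) {D E : Submodule ℂ V} (hD : IsCut 𝓕 D)
    (hE : E ∈ 𝓕 ∨ IsCut 𝓕 E) {v : V} (hv : v ∈ D) (hvE : v ∉ E) :
    ∃ F' F'', IsImmediatePair 𝓕 F' F'' ∧ F'' ≤ D ∧ E ≤ F' ∧ v ∈ F'' ∧ v ∉ F' := by
  obtain ⟨F', F'', hp, h1, h2⟩ := h.caught v (by rintro rfl; exact hvE E.zero_mem)
  refine ⟨F', F'', hp, ?_, ?_, h1, h2⟩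
  · exact (hD _ _ hp).resolve_left fun hle => h2 (hle hv)
  · exact ((hE.elim h.isCut id) _ _ hp).resolve_right fun hle => hvE (hle h1)

/-- The pair catching a vector of `D` outside `E` lies below `D` and above `E`. -/
theorem IsCut.total (h : IsGeneralizedFlag 𝓕) {D E : Submodule ℂ V} (hD : IsCut 𝓕 D)
    (hE : IsCut 𝓕 E) : D ≤ E ∨ E ≤ D := by
  by_contra! hh
  obtain ⟨v, hv, hvE⟩ := SetLike.not_le_iff_exists.1 hh.1
  obtain ⟨F', F'', hp, h1, h2, -⟩ := hD.exists_pair h (.inr hE) hv hvE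
  exact hh.2 (h2.trans (hp.2.2.1.le.trans h1))

theorem IsCut.stable (h : IsGeneralizedFlag 𝓕) {D : Submodule ℂ V} (hD : IsCut 𝓕 D)
    {X : Module.End ℂ V} (hX : ∀ F ∈ 𝓕, ∀ v ∈ F, X v ∈ F) : ∀ v ∈ D, X v ∈ D := by
  intro v hv
  by_cases h0 : v = 0
  · simp [h0]
  obtain ⟨F', F'', hp, h1, h2⟩ := h.caught v h0
  exact ((hD _ _ hp).resolve_left fun hle => h2 (hle hv)) (hX _ hp.2.1 _ h1)

variable {B : LinearMap.BilinForm ℂ V}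

/-- Semiclosedness only speaks of lower members of pairs; this covers every member. A vector `v` of
the closure outside `F` is caught by a pair above `F` whose lower member has the upper one as
closure. Were that lower member larger than `F`, a pair in between would have a lower member whose
closure both contains and misses `v`. -/
theorem IsSemiclosed.closure_dichotomy (hB : B.IsSymm) (h : IsSemiclosed B 𝓕) {F : Submodule ℂ V}
    (hF : F ∈ 𝓕) :
    mackeyClosure B F = F ∨ IsImmediatePair 𝓕 F (mackeyClosure B F) := by
  have hg := h.toIsGeneralizedFlag
  by_cases hle : mackeyClosure B F ≤ F
  · exact .inl (le_antisymm hle (le_closure hB F))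
  right
  obtain ⟨v, hv, hvF⟩ := SetLike.not_le_iff_exists.1 hle
  have key : ∀ w, w ∈ mackeyClosure B F → w ∉ F → ∀ F' F'', IsImmediatePair 𝓕 F' F'' →
      F ≤ F' → w ∈ F'' → w ∉ F' → mackeyClosure B F' = F'' := by
    intro w hw hwF F' F'' hp hFF' hw2 hw1
    refine (h.closure_eq _ _ hp).resolve_left fun hc => hw1 ?_
    exact closure_le_of_closed hc hFF' hw
  obtain ⟨F', F'', hp, hv2, hv1⟩ := hg.caught v (by rintro rfl; exact hvF F.zero_mem)
  have hFF' : F ≤ F' := (hg.isCut hF _ _ hp).resolve_right fun hle => hvF (hle hv2)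
  have hc := key v hv hvF _ _ hp hFF' hv2 hv1
  have hFeq : F = F' := by
    refine le_antisymm hFF' ?_
    by_contra hn
    obtain ⟨w, hw, hwF⟩ := SetLike.not_le_iff_exists.1 hn
    obtain ⟨G', G'', hq, h1, h2, hw2, hw1⟩ :=
      (hg.isCut hp.1).exists_pair hg (.inl hF) hw hwF
    rcases h.closure_eq _ _ hq with hcl | hcl
    · exact hv1 (hq.2.2.1.le.trans h1 (hcl.le (closure_mono h2 hv)))
    · exact hv1 (h1 (hcl.le (closure_mono h2 hv)))
  subst hFeq
  rw [hc]
  exact hp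

theorem IsSemiclosed.closure_mem (hB : B.IsSymm) (h : IsSemiclosed B 𝓕) {F : Submodule ℂ V}
    (hF : F ∈ 𝓕) : mackeyClosure B F ∈ 𝓕 := by
  rcases h.closure_dichotomy hB hF with h1 | h1
  · rwa [h1]
  · exact h1.2.1

theorem rankOne_mem_glInf (v w : V) : rankOne B v w ∈ glInf B :=
  Submodule.subset_span ⟨v, w, rfl⟩

theorem IsGeneralizedFlag.rankOne_mem_stabilizer (h : IsGeneralizedFlag 𝓕)
    {F' F'' : Submodule ℂ V} (hp : IsImmediatePair 𝓕 F' F'') {f y : V} (hf : f ∈ F'')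
    (hy : y ∈ B.orthogonal F') : rankOne B f y ∈ stabilizer (glInf B) 𝓕 := by
  refine ⟨rankOne_mem_glInf f y, fun F hF x hx => ?_⟩
  rw [rankOne_apply]
  rcases h.isCut hF _ _ hp with h1 | h1
  · rw [mem_orth.1 hy x (h1 hx), zero_smul]
    exact F.zero_mem
  · exact F.smul_mem _ (h1 hf)

/-- For `f ∈ F''` and `y ∈ F'ᗮ` the operator `rankOne B f y` stabilizes the flag, hence also `Fᗮ`.
Applied to `u ∈ Fᗮ` with ⟨u, y⟩ ≠ 0 it puts `f` into `Fᗮ`. -/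
theorem IsSelfTaut.isCut_orth (hB : B.IsSymm) (h : IsSelfTaut B 𝓕) {F : Submodule ℂ V}
    (hF : F ∈ 𝓕) : IsCut 𝓕 (B.orthogonal F) := by
  have hg := h.toIsGeneralizedFlag
  have key : ∀ F' F'', IsImmediatePair 𝓕 F' F'' → ∀ u ∈ B.orthogonal F,
      u ∉ mackeyClosure B F' → F'' ≤ B.orthogonal F := by
    intro F' F'' hp u hu huF f hf
    obtain ⟨y, hy, huy⟩ := exists_orth_ne hB huF
    have := h.stable _ (hg.rankOne_mem_stabilizer hp hf hy) F hF u hu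
    rw [rankOne_apply] at this
    exact ((B.orthogonal F).smul_mem_iff huy).1 this
  intro F' F'' hp
  by_cases hle : B.orthogonal F ≤ F'
  · exact .inl hle
  right
  obtain ⟨u, hu, huF⟩ := SetLike.not_le_iff_exists.1 hle
  rcases h.closure_eq _ _ hp with hc | hc
  · exact key _ _ hp u hu (by rwa [hc])
  -- Here `u` may lie in the closure of `F'`, so no such `y` need exist. As `Fᗮ` is closed, it
  -- suffices to treat the vectors of `F'`, through the lower pairs catching them.
  · rw [← hc]
    refine closure_le_of_closed (closure_orth hB F) fun f hf => ?_
    by_cases hf0 : f = 0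
    · simp [hf0]
    obtain ⟨G', G'', hq, hf2, hf1⟩ := hg.caught f hf0
    have hG : G'' ≤ F' := (hg.isCut hp.1 _ _ hq).resolve_left fun hle => hf1 (hle hf)
    refine key _ _ hq u hu (fun huG => huF (hG ?_)) hf2
    rcases h.closure_eq _ _ hq with hd | hd
    · exact hq.2.2.1.le (hd.le huG)
    · exact hd.le huG

/-- Converse of `IsSelfTaut.isCut_orth`: a test for self-tautness that involves no operators. -/
theorem isSelfTaut_of_isCut_orth (h : IsSemiclosed B 𝓕)
    (hc : ∀ F ∈ 𝓕, IsCut 𝓕 (B.orthogonal F)) : IsSelfTaut B 𝓕 where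
  toIsSemiclosed := h
  stable _ hX F hF := (hc F hF).stable h.toIsGeneralizedFlag hX.2

theorem IsSelfTaut.le_orth_or (hB : B.IsSymm) (h : IsSelfTaut B 𝓕) {F : Submodule ℂ V}
    (hF : F ∈ 𝓕) : F ≤ B.orthogonal F ∨ B.orthogonal F ≤ F :=
  (h.toIsGeneralizedFlag.isCut hF).total h.toIsGeneralizedFlag (h.isCut_orth hB hF)

end Cuts

/-! ### Skew operators of the form v ∧ w in the stabilizer -/

section Wedges

variable {V : Type*} [AddCommGroup V] [Module ℂ V] {𝓕 : Set (Submodule ℂ V)}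

/-- The operators mapping the upper member of each immediate pair of `𝓕` into the lower one. -/
def StrictlyLowers (𝓕 : Set (Submodule ℂ V)) (X : Module.End ℂ V) : Prop :=
  ∀ F' F'', IsImmediatePair 𝓕 F' F'' → ∀ v ∈ F'', X v ∈ F'

variable (B : LinearMap.BilinForm ℂ V)

/-- The skew operator `v ∧ w`, that is, `x ↦ ⟨x, w⟩ v - ⟨x, v⟩ w`. -/
def wedge (v w : V) : Module.End ℂ V := rankOne B v w - rankOne B w v

variable {B}

theorem wedge_apply (v w x : V) : wedge B v w x = B x w • v - B x v • w := rfl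

theorem wedge_swap (v w : V) : wedge B v w = -wedge B w v := by
  simp [wedge]

theorem wedge_mem_soInf (hB : B.IsSymm) (v w : V) : wedge B v w ∈ soInf B := by
  refine ⟨sub_mem (rankOne_mem_glInf v w) (rankOne_mem_glInf w v), ?_⟩
  intro x y
  simp only [wedge_apply, map_sub, map_smul, LinearMap.sub_apply, LinearMap.smul_apply,
    smul_eq_mul, LinearMap.neg_apply]
  rw [hB.eq v y, hB.eq w y]
  ring

theorem wedge_mem_stabilizer (hB : B.IsSymm) {f y : V}
    (h : ∀ F ∈ 𝓕, ∀ x ∈ F, B x y • f ∈ F ∧ B x f • y ∈ F) :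
    wedge B f y ∈ stabilizer (soInf B) 𝓕 :=
  ⟨wedge_mem_soInf hB f y, fun F hF x hx => F.sub_mem (h F hF x hx).1 (h F hF x hx).2⟩

/-- Two specializations matter: `e` isotropic, orthogonal to `y`, with ⟨e, z⟩ = 1 exhibits `e ∧ y`
as a commutator; `e` nonisotropic and orthogonal to `y` and `z` does so for `z ∧ y`, up to a nonzero
scalar. -/
theorem lie_wedge_wedge_common (hB : B.IsSymm) (e y z : V) :
    ⁅wedge B e z, wedge B e y⁆ =
      B e z • wedge B e y - B e e • wedge B z y - B e y • wedge B e z := by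
  ext x
  rw [Ring.lie_def]
  simp only [LinearMap.sub_apply, Module.End.mul_apply, LinearMap.smul_apply, wedge_apply, map_sub,
    map_smul]
  rw [hB.eq z e, hB.eq y e, hB.eq y z]
  module

/-- Invariance of `U` under the strictly lowering operators in the `so`-stabilizer of `𝓕`
and under the commutators of that stabilizer. -/
structure IsWeaklyStable (B : LinearMap.BilinForm ℂ V) (𝓕 : Set (Submodule ℂ V))
    (U : Submodule ℂ V) : Prop where
  lowering : ∀ X ∈ stabilizer (soInf B) 𝓕, StrictlyLowers 𝓕 X → ∀ u ∈ U, X u ∈ U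
  lie : ∀ X ∈ stabilizer (soInf B) 𝓕, ∀ Y ∈ stabilizer (soInf B) 𝓕, ∀ u ∈ U, ⁅X, Y⁆ u ∈ U

variable {U : Submodule ℂ V}

theorem IsSelfTaut.wedge_lowering (hB : B.IsSymm) (h : IsSelfTaut B 𝓕) {F : Submodule ℂ V}
    (hF : F ∈ 𝓕) {f y : V} (hf : f ∈ F) (hy : y ∈ B.orthogonal F) :
    wedge B f y ∈ stabilizer (soInf B) 𝓕 ∧ StrictlyLowers 𝓕 (wedge B f y) := by
  have hg := h.toIsGeneralizedFlag
  constructor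
  · refine wedge_mem_stabilizer hB fun G hG x hx => ⟨?_, ?_⟩
    · rcases hg.chain.total hG hF with h1 | h1
      · simp [mem_orth.1 hy x (h1 hx)]
      · exact G.smul_mem _ (h1 hf)
    · rcases (hg.isCut hG).total hg (h.isCut_orth hB hF) with h1 | h1
      · simp [(mem_orth' hB).1 (h1 hx) f hf]
      · exact G.smul_mem _ (h1 hy)
  · intro F' F'' hp x hx
    rw [wedge_apply]
    refine F'.sub_mem ?_ ?_
    · rcases hg.isCut hF _ _ hp with h1 | h1
      · exact F'.smul_mem _ (h1 hf)
      · simp [mem_orth.1 hy x (h1 hx)]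
    · rcases h.isCut_orth hB hF _ _ hp with h1 | h1
      · exact F'.smul_mem _ (h1 hy)
      · simp [(mem_orth' hB).1 (h1 hx) f hf]

theorem IsWeaklyStable.wedge_orth (hB : B.IsSymm) (h : IsSelfTaut B 𝓕) (hU : IsWeaklyStable B 𝓕 U)
    {F : Submodule ℂ V} (hF : F ∈ 𝓕) {f y u : V} (hf : f ∈ F) (hy : y ∈ B.orthogonal F)
    (hu : u ∈ U) : wedge B f y u ∈ U :=
  have hw := h.wedge_lowering hB hF hf hy
  hU.lowering _ hw.1 hw.2 u hu

/-- Above an immediate pair `K < H` with `K` closed, there is a dense subspace `A` of `Kᗮ` such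
that `H ∧ A` lies in the stabilizer. -/
theorem IsSelfTaut.exists_dual (hB : B.IsSymm) (h : IsSelfTaut B 𝓕) {K H : Submodule ℂ V}
    (hp : IsImmediatePair 𝓕 K H) (hK : mackeyClosure B K = K) :
    ∃ A : Submodule ℂ V, B.orthogonal A = K ∧ (A = B.orthogonal K ∨ A ∈ 𝓕) ∧
      ∀ f ∈ H, ∀ y ∈ A, wedge B f y ∈ stabilizer (soInf B) 𝓕 := by
  have hg := h.toIsGeneralizedFlag
  have step : ∀ F ∈ 𝓕, B.orthogonal F ≤ K → F ≤ B.orthogonal K ∧ B.orthogonal F = K ∨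
      B.orthogonal K ≤ F := by
    intro F hF hFK
    rcases (hg.isCut hF).total hg (h.isCut_orth hB hp.1) with h1 | h1
    · exact .inl ⟨h1, le_antisymm hFK (hK.ge.trans (orth_anti h1))⟩
    · exact .inr h1
  have main : ∀ A : Submodule ℂ V, B.orthogonal A = K → A ≤ B.orthogonal K →
      (∀ F ∈ 𝓕, B.orthogonal F ≤ K → A ≤ F) →
      ∀ f ∈ H, ∀ y ∈ A, wedge B f y ∈ stabilizer (soInf B) 𝓕 := by
    intro A hA hAK hmin f hf y hy
    refine wedge_mem_stabilizer hB fun F hF x hx => ⟨?_, ?_⟩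
    · rcases hg.isCut hF _ _ hp with h1 | h1
      · simp [mem_orth.1 (hAK hy) x (h1 hx)]
      · exact F.smul_mem _ (h1 hf)
    · rcases h.isCut_orth hB hF _ _ hp with h1 | h1
      · exact F.smul_mem _ (hmin F hF h1 hy)
      · simp [mem_orth.1 (h1 hf) x hx]
  -- A member `P` dense in `Kᗮ` but not equal to it is itself stabilized, so `y` must be taken from
  -- `P`. Semiclosedness makes `P` minimal: a pair between a smaller `F` and `P` would have a lower
  -- member with closure `Kᗮ`, forcing `P = Kᗮ`.
  by_cases hP : ∃ P ∈ 𝓕, B.orthogonal P = K ∧ P ≠ B.orthogonal K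
  · obtain ⟨P, hP, hPK, hne⟩ := hP
    have hPle : P ≤ B.orthogonal K := hPK ▸ le_closure hB P
    refine ⟨P, hPK, .inr hP, main P hPK hPle fun F hF hFK => ?_⟩
    rcases step F hF hFK with ⟨-, h2⟩ | h2
    · by_contra hn
      obtain ⟨v, hv, hvF⟩ := SetLike.not_le_iff_exists.1 hn
      obtain ⟨F', F'', hq, h3, h4, h5, h6⟩ :=
        (hg.isCut hP).exists_pair hg (.inl hF) hv hvF
      have hcl : B.orthogonal K ≤ mackeyClosure B F' := by
        rw [← h2]
        exact closure_mono h4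
      have : mackeyClosure B F' ≤ F'' := by
        rcases h.closure_eq _ _ hq with hc | hc
        · exact hc.le.trans hq.2.2.1.le
        · exact hc.le
      exact hne (le_antisymm hPle (hcl.trans (this.trans h3)))
    · exact hPle.trans h2
  · push Not at hP
    refine ⟨B.orthogonal K, hK, .inl rfl, main _ hK le_rfl fun F hF hFK => ?_⟩
    rcases step F hF hFK with ⟨-, h2⟩ | h2
    · exact (hP F hF h2).ge
    · exact h2

theorem IsWeaklyStable.wedge_isotropic (hB : B.IsSymm) (hU : IsWeaklyStable B 𝓕 U)
    {K A : Submodule ℂ V} (hA : B.orthogonal A = K) {e y u : V} (heK : e ∉ K)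
    (hs : ∀ y ∈ A, wedge B e y ∈ stabilizer (soInf B) 𝓕) (hy : y ∈ A) (he : B e e = 0)
    (hey : B e y = 0) (hu : u ∈ U) : wedge B e y u ∈ U := by
  obtain ⟨z, hz, hez⟩ := exists_eq_one hB hA.le heK
  have := hU.lie _ (hs z hz) _ (hs y hy) u hu
  rwa [lie_wedge_wedge_common hB, he, hey, hez, one_smul, zero_smul, zero_smul, sub_zero,
    sub_zero] at this

end Wedges

/-! ### Closed members lie in every weakly stable subspace that leaves them -/

section Generation

variable {V : Type*} [AddCommGroup V] [Module ℂ V] {𝓕 : Set (Submodule ℂ V)}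
  {B : LinearMap.BilinForm ℂ V} {U : Submodule ℂ V}

/-- Every exceptional member `K` of `𝓕` forms an immediate pair with `Kᗮ`. -/
def IsReduced (B : LinearMap.BilinForm ℂ V) (𝓕 : Set (Submodule ℂ V)) : Prop :=
  ∀ K, IsExceptional B 𝓕 K → IsImmediatePair 𝓕 K (B.orthogonal K)

theorem smul_mem_of_ne {F : Submodule ℂ V} {c : ℂ} (hc : c ≠ 0) {v : V} (h : c • v ∈ F) : v ∈ F :=
  (F.smul_mem_iff hc).1 h

/-- With `y ∈ Fᗮ` and ⟨u, y⟩ = 1, the lowering operator `f ∧ y` sends `u` to `f`. -/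
theorem IsWeaklyStable.mem_of_orth (hB : B.IsSymm) (h : IsSelfTaut B 𝓕)
    (hU : IsWeaklyStable B 𝓕 U) {F : Submodule ℂ V} (hF : F ∈ 𝓕) (hcl : mackeyClosure B F = F)
    {u f : V} (hu : u ∈ U) (huF : u ∉ F) (hf : f ∈ F) (hfu : B u f = 0) : f ∈ U := by
  obtain ⟨y, hy, huy⟩ := exists_eq_one hB hcl.le huF
  have := hU.wedge_orth hB h hF hf hy hu
  rwa [wedge_apply, huy, hfu, one_smul, zero_smul, sub_zero] at this

theorem IsWeaklyStable.le_of_mem (hB : B.IsSymm) (h : IsSelfTaut B 𝓕)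
    (hU : IsWeaklyStable B 𝓕 U) {F : Submodule ℂ V} (hF : F ∈ 𝓕) (hcl : mackeyClosure B F = F)
    {u e : V} (hu : u ∈ U) (huF : u ∉ F) (heF : e ∈ F) (heU : e ∈ U) (heu : B u e ≠ 0) :
    F ≤ U := by
  intro f hf
  have := hU.mem_of_orth hB h hF hcl hu huF (f := f - (B u f / B u e) • e)
    (F.sub_mem hf (F.smul_mem _ heF)) (by simp [heu])
  simpa using U.add_mem this (U.smul_mem (B u f / B u e) heU)

/-- If ⟨u, e⟩ ≠ 0 for some `e ∈ F`, correct a vector of `Fᗮ` outside `F` by a multiple of `e` to get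
`w ⟂ u`. Then `e ∧ w` maps `u` to a multiple of `w`, a further wedge maps `w` to `e`, and `e ∈ U`
suffices. -/
theorem IsWeaklyStable.le_of_isotropic (hB : B.IsSymm) (h : IsSelfTaut B 𝓕)
    (hU : IsWeaklyStable B 𝓕 U) {F : Submodule ℂ V} (hF : F ∈ 𝓕) (hcl : mackeyClosure B F = F)
    (hlt : F < B.orthogonal F) {u : V} (hu : u ∈ U) (huF : u ∉ F) : F ≤ U := by
  by_cases hperp : ∀ f ∈ F, B u f = 0
  · exact fun f hf => hU.mem_of_orth hB h hF hcl hu huF hf (hperp f hf)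
  push Not at hperp
  obtain ⟨e, he, hue⟩ := hperp
  obtain ⟨z, hz, hzF⟩ := SetLike.exists_of_lt hlt
  obtain ⟨w, hwF, hw, huw⟩ : ∃ w, w ∉ F ∧ w ∈ B.orthogonal F ∧ B u w = 0 := by
    refine ⟨z - (B u z / B u e) • e, fun hn => hzF ?_, ?_, by simp [hue]⟩
    · simpa using F.add_mem hn (F.smul_mem (B u z / B u e) he)
    · exact Submodule.sub_mem _ hz (Submodule.smul_mem _ _ (hlt.le he))
  have hwU : w ∈ U := by
    have := hU.wedge_orth hB h hF he hw hu
    rw [wedge_apply, huw, zero_smul, zero_sub, ← neg_smul] at this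
    exact smul_mem_of_ne (neg_ne_zero.2 hue) this
  obtain ⟨y, hy, hwy⟩ := exists_eq_one hB hcl.le hwF
  have heU := hU.wedge_orth hB h hF he hy hwU
  rw [wedge_apply, hwy, (mem_orth' hB).1 hw e he, one_smul, zero_smul, sub_zero] at heU
  exact hU.le_of_mem hB h hF hcl hu huF he heU hue

/-- With `b ∈ Kᗮ` and ⟨e, b⟩ = 1, each `x ∈ Kᗮ` becomes orthogonal to `K` and `e` after subtracting
⟨e, x⟩ b, hence lies in `Fᗮ = F`. So `e` and `b` give a basis of `Kᗮ / K`. -/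
theorem isExceptional_of_sup_span {K : Submodule ℂ V} (hB : B.IsSymm) (hK : K ∈ 𝓕)
    (hcl : mackeyClosure B K = K) {F : Submodule ℂ V} (hF : B.orthogonal F = F) {e : V}
    (he : e ∉ K) (hFe : F = K ⊔ Submodule.span ℂ {e}) : IsExceptional B 𝓕 K := by
  have heF : e ∈ F := hFe ▸ (le_sup_right (a := K)) (Submodule.mem_span_singleton_self e)
  have hKF : K ≤ F := hFe ▸ le_sup_left
  have hFK : F ≤ B.orthogonal K := hF.ge.trans (orth_anti hKF)
  have hmem : ∀ x ∈ B.orthogonal K, B x e = 0 → x ∈ F := by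
    intro x hx hxe
    rw [← hF]
    refine (mem_orth' hB).2 fun y hy => ?_
    rw [hFe] at hy
    obtain ⟨k, hk, w, hw, rfl⟩ := Submodule.mem_sup.1 hy
    obtain ⟨t, rfl⟩ := Submodule.mem_span_singleton.1 hw
    simp [(mem_orth' hB).1 hx k hk, hxe]
  have hee : B e e = 0 := mem_orth.1 (hF.ge heF) e heF
  obtain ⟨b, hb, heb⟩ := exists_eq_one hB hcl.le he
  refine ⟨hK, hKF.trans hFK, hcl, finrank_quotient_eq_two_iff.2
    ⟨e, hFK heF, b, hb, fun s t hst => ?_, fun x hx => ?_⟩⟩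
  · have ht : t = 0 := by
      have := mem_orth.1 (hFK heF) _ hst
      rw [hB.eq] at this
      simpa [hee, heb] using this
    refine ⟨?_, ht⟩
    by_contra hs
    exact he (smul_mem_of_ne hs (by simpa [ht] using hst))
  · have h1 : x - B e x • b ∈ F := by
      refine hmem _ (Submodule.sub_mem _ hx (Submodule.smul_mem _ _ hb)) ?_
      rw [hB.eq]
      simp [heb]
    rw [hFe, mem_sup_span_singleton_iff] at h1
    obtain ⟨c, hc⟩ := h1
    exact ⟨c, B e x, by convert hc using 1; module⟩

/-- A failure forces `F = Fᗮ`, with a pair `K < H` such that `H` is dense in `F` and `K`, but not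
`H`, is orthogonal to `u`. If `H` has a vector `f ⟂ u` outside `K`, then `f ∈ U`, and a wedge sends
`f` to some `e ∈ H` not orthogonal to `u`. Otherwise `H / K` is a line, so `K` is exceptional and
`F` lies strictly between `K` and `Kᗮ`, which a reduced flag forbids. -/
theorem IsWeaklyStable.le_of_closed (hB : B.IsSymm) (h : IsSelfTaut B 𝓕) (hr : IsReduced B 𝓕)
    (hU : IsWeaklyStable B 𝓕 U) {F : Submodule ℂ V} (hF : F ∈ 𝓕) (hcl : mackeyClosure B F = F)
    {u : V} (hu : u ∈ U) (huF : u ∉ F) : F ≤ U := by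
  have hg := h.toIsGeneralizedFlag
  by_contra hFU
  have hFF : B.orthogonal F ≤ F := by
    rcases h.le_orth_or hB hF with h1 | h1
    · rcases h1.lt_or_eq with h2 | h2
      · exact absurd (hU.le_of_isotropic hB h hF hcl h2 hu huF) hFU
      · exact h2.ge
    · exact h1
  -- closed isotropic members not orthogonal to `u` must coincide with `F`
  have key : ∀ C ∈ 𝓕, mackeyClosure B C = C → C ≤ B.orthogonal F → (∃ e ∈ C, B u e ≠ 0) →
      C = F ∧ B.orthogonal F = F := by
    intro C hC hCcl hCF ⟨e, he, hue⟩
    have h1 : C ≤ B.orthogonal C := hCF.trans (orth_anti (hCF.trans hFF))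
    have h2 : C = B.orthogonal C := by
      by_contra hne
      refine hFU (hU.le_of_mem hB h hF hcl hu huF (hFF (hCF he)) ?_ hue)
      exact hU.le_of_isotropic hB h hC hCcl (h1.lt_of_ne hne) hu
        (fun hn => huF (hFF (hCF hn))) he
    have h3 : F ≤ C := by
      rw [h2]
      exact le_orth_comm hB hCF
    have h4 := le_antisymm (hCF.trans hFF) h3
    exact ⟨h4, by rw [← h4]; exact h2.symm⟩
  have hex : ∃ e ∈ B.orthogonal F, B u e ≠ 0 := exists_orth_ne hB (by rwa [hcl])
  have key2 : ∀ D : Submodule ℂ V, IsCut 𝓕 D → D ≤ B.orthogonal F → (∃ e ∈ D, B u e ≠ 0) →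
      ∃ K H, IsImmediatePair 𝓕 K H ∧ H ≤ D ∧ mackeyClosure B H = F ∧ (∃ e ∈ H, B u e ≠ 0) := by
    intro D hD hDF ⟨e, he, hue⟩
    obtain ⟨K, H, hp, h2, h1⟩ := hg.caught e (by rintro rfl; simp at hue)
    have hHD : H ≤ D := (hD _ _ hp).resolve_left fun hle => h1 (hle he)
    refine ⟨K, H, hp, hHD, ?_, e, h2, hue⟩
    refine (key _ (h.closure_mem hB hp.2.1) (closure_closure hB H) ?_
      ⟨e, le_closure hB _ h2, hue⟩).1
    exact closure_le_of_closed (closure_orth hB F) (hHD.trans hDF)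
  obtain ⟨K, H, hp, hHF, hHcl, hKcl, hHu⟩ : ∃ K H, IsImmediatePair 𝓕 K H ∧ H ≤ B.orthogonal F ∧
      mackeyClosure B H = F ∧ mackeyClosure B K = K ∧ (∃ e ∈ H, B u e ≠ 0) := by
    obtain ⟨K, H, hp, h1, h2, e, he, hue⟩ := key2 _ (h.isCut_orth hB hF) le_rfl hex
    rcases h.closure_eq _ _ hp with hc | hc
    · exact ⟨K, H, hp, h1, h2, hc, e, he, hue⟩
    -- If `K` is not closed it has the same orthogonal complement as `H`, so the search can be
    -- repeated inside `K`. Two successive pairs of this kind would give `H = F = H'`, although `H'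
    -- ≤ K < H`.
    · have : ∃ e ∈ K, B u e ≠ 0 := by
        by_contra! hn
        have hu' : u ∈ B.orthogonal K := (mem_orth' hB).2 hn
        rw [← orth_closure hB, hc] at hu'
        exact hue ((mem_orth' hB).1 hu' e he)
      obtain ⟨K', H', hp', h1', h2', h3'⟩ :=
        key2 K (hg.isCut hp.1) (hp.2.2.1.le.trans h1) this
      refine ⟨K', H', hp', h1'.trans (hp.2.2.1.le.trans h1), h2', ?_, h3'⟩
      refine (h.closure_eq _ _ hp').resolve_right fun hc' => ?_
      have hHF : H = F := by rw [← h2, ← hc, closure_closure hB]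
      have hH' : H' = F := by rw [← h2', ← hc', closure_closure hB]
      exact (hp.2.2.1.trans_le (hHF.trans hH'.symm).le).not_ge h1'
  obtain ⟨e, he, hue⟩ := hHu
  have hLag : B.orthogonal F = F := by
    refine (key F hF hcl ?_ ⟨e, hFF (hHF he), hue⟩).2
    rw [← hHcl]
    exact closure_le_of_closed (closure_orth hB _) (by rwa [hHcl])
  have hKF : K < F := hp.2.2.1.trans_le (hHF.trans hFF)
  have hKu : ∀ k ∈ K, B u k = 0 := by
    by_contra! hn
    exact hKF.ne (key K hp.1 hKcl (hKF.le.trans hLag.ge) hn).1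
  have heK : e ∉ K := fun hn => hue (hKu e hn)
  by_cases hdim : ∃ f ∈ H, f ∉ K ∧ B u f = 0
  · obtain ⟨f, hf, hfK, huf⟩ := hdim
    have hfU : f ∈ U := hU.mem_of_orth hB h hF hcl hu huF (hFF (hHF hf)) huf
    obtain ⟨A, hA, -, hAs⟩ := h.exists_dual hB hp hKcl
    obtain ⟨y, hy, hey, hfy⟩ := exists_orth_and_eq_one hB hA.le (u := f) (v := e) fun c hc => by
      have := hKu _ hc
      rw [map_sub, huf, map_smul, zero_sub, neg_eq_zero, smul_eq_zero] at this
      rcases this with rfl | h1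
      · exact hfK (by simpa using hc)
      · exact hue h1
    have hiso : ∀ x ∈ H, B x e = 0 := fun x hx =>
      mem_orth.1 (hHF he) x (hFF (hHF hx))
    have heU := hU.wedge_isotropic hB hA heK (hAs e he) hy (hiso e he) hey hfU
    rw [wedge_apply, hfy, hiso f hf, one_smul, zero_smul, sub_zero] at heU
    exact hFU (hU.le_of_mem hB h hF hcl hu huF (hFF (hHF he)) heU hue)
  · push Not at hdim
    have hHe : H = K ⊔ Submodule.span ℂ {e} := by
      refine le_antisymm (fun x hx => mem_sup_span_singleton_iff.2 ⟨B u x / B u e, ?_⟩)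
        (sup_le hp.2.2.1.le (by simpa using he))
      by_contra hn
      exact hdim _ (H.sub_mem hx (H.smul_mem _ he)) hn (by simp [hue])
    have hFe : F = K ⊔ Submodule.span ℂ {e} := by
      rw [← hHcl, hHe, closed_sup_span_singleton hB hKcl]
    have hpair := hr K (isExceptional_of_sup_span hB hp.1 hKcl hLag heK hFe)
    refine hpair.2.2.2 F hF ⟨hKF, (hLag.ge.trans (orth_anti hKF.le)).lt_of_ne fun hn => ?_⟩
    apply hKF.ne
    rw [← hKcl, mackeyClosure, ← hn, hLag]

end Generation

/-! ### Weakly stable subspaces and immediate pairs: isotropic, coisotropic and self-dual cases -/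

section Generation

variable {V : Type*} [AddCommGroup V] [Module ℂ V] {𝓕 : Set (Submodule ℂ V)}
  {B : LinearMap.BilinForm ℂ V} {U K H : Submodule ℂ V} {u : V}

theorem mem_of_sub_smul_mem (hKU : K ≤ U) (hu : u ∈ U) (huK : u ∉ K) {c : ℂ} {f : V}
    (h : u - c • f ∈ K) : f ∈ U := by
  have hc : c ≠ 0 := by
    rintro rfl
    exact huK (by simpa using h)
  exact smul_mem_of_ne hc (by simpa using U.sub_mem hu (hKU h))

theorem IsSemiclosed.closure_lower_le (h : IsSemiclosed B 𝓕) (hp : IsImmediatePair 𝓕 K H) :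
    mackeyClosure B K ≤ H := by
  rcases h.closure_eq _ _ hp with hc | hc
  · exact hc.le.trans hp.2.2.1.le
  · exact hc.le

/-- For `f ∈ H` independent of `u` modulo `K`, choose `y` with `y ⟂ f` and ⟨u, y⟩ = 1. Isotropy
makes `f ∧ y` a commutator and gives `u ⟂ f`, so it maps `u` to `f`. -/
theorem IsWeaklyStable.le_of_pair_isotropic (hB : B.IsSymm) (h : IsSelfTaut B 𝓕)
    (hU : IsWeaklyStable B 𝓕 U) (hp : IsImmediatePair 𝓕 K H) (hcl : mackeyClosure B K = K)
    (hKU : K ≤ U) (hu : u ∈ U) (huK : u ∉ K) (huH : u ∈ mackeyClosure B H)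
    (hiso : H ≤ B.orthogonal H) : H ≤ U := by
  obtain ⟨A, hA, -, hAs⟩ := h.exists_dual hB hp hcl
  intro f hf
  by_cases hfK : f ∈ K
  · exact hKU hfK
  by_cases hc : ∃ c : ℂ, u - c • f ∈ K
  · exact mem_of_sub_smul_mem hKU hu huK hc.choose_spec
  push Not at hc
  obtain ⟨y, hy, hfy, huy⟩ := exists_orth_and_eq_one hB hA.le hc
  have := hU.wedge_isotropic hB hA hfK (hAs f hf) hy (mem_orth.1 (hiso hf) f hf) hfy hu
  rwa [wedge_apply, huy, (mem_orth' hB).1 huH f (hiso hf), one_smul, zero_smul, sub_zero] at this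

/-- For `e ∈ Kᗮ` with `e ⟂ v` and ⟨u, e⟩ = 1, the operator `e ∧ v` maps `u` to ⟨u, v⟩ e − v, and `e
∈ Kᗮ ≤ K ≤ U`. That `e ∧ v` is available is seen from the dual pair catching `e`, whose lower member
is `Hᗮ`. -/
theorem IsWeaklyStable.le_of_pair_coisotropic (hB : B.IsSymm) (h : IsSelfTaut B 𝓕)
    (hU : IsWeaklyStable B 𝓕 U) (hp : IsImmediatePair 𝓕 K H) (hcl : mackeyClosure B K = K)
    (hKU : K ≤ U) (hu : u ∈ U) (huK : u ∉ K) (huH : u ∈ mackeyClosure B H)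
    (hco : B.orthogonal K ≤ K) : H ≤ U := by
  have hg := h.toIsGeneralizedFlag
  intro v hv
  by_cases hc : ∃ c : ℂ, u - c • v ∈ K
  · exact mem_of_sub_smul_mem hKU hu huK hc.choose_spec
  push Not at hc
  have hcaught : ∀ D : Submodule ℂ V, IsCut 𝓕 D → D ≤ B.orthogonal K → B.orthogonal D ≤ K →
      ∃ K' H' e, IsImmediatePair 𝓕 K' H' ∧ H' ≤ D ∧ e ∈ H' ∧ e ∉ K' ∧ B v e = 0 ∧ B u e = 1 ∧
        (H ≤ B.orthogonal K' ∨ B.orthogonal K ≤ H') := by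
    intro D hD hDK hK
    obtain ⟨e, he, hve, hue⟩ := exists_orth_and_eq_one hB hK hc
    obtain ⟨K', H', hp', h2, h1⟩ := hg.caught e (by rintro rfl; simp at hue)
    refine ⟨K', H', e, hp', (hD _ _ hp').resolve_left fun hle => h1 (hle he), h2, h1, hve, hue, ?_⟩
    rcases h.isCut_orth hB hp'.1 _ _ hp with h3 | h3
    · exact .inr ((orth_anti h3).trans (h.closure_lower_le hp'))
    · exact .inl h3
  obtain ⟨K', H', e, hp', hH', heH, heK, hve, hue, hHK⟩ : ∃ K' H' e, IsImmediatePair 𝓕 K' H' ∧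
      H' ≤ B.orthogonal K ∧ e ∈ H' ∧ e ∉ K' ∧ B v e = 0 ∧ B u e = 1 ∧ H ≤ B.orthogonal K' := by
    obtain ⟨K', H', e, hp', hH', heH, heK, hve, hue, h3 | h3⟩ :=
      hcaught _ (h.isCut_orth hB hp.1) le_rfl hcl.le
    · exact ⟨K', H', e, hp', hH', heH, heK, hve, hue, h3⟩
    have hH'eq := le_antisymm hH' h3
    -- When `H' = Kᗮ`, either `K'` is itself dense enough in `Kᗮ` to choose `e` again inside it,
    -- which excludes this case, or the cut `K'ᗮ` must contain `H`.
    by_cases hKK : B.orthogonal K' ≤ K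
    · obtain ⟨K₁, H₁, e₁, hp₁, hH₁, heH₁, heK₁, hve₁, hue₁, h4 | h4⟩ :=
        hcaught K' (hg.isCut hp'.1) (hp'.2.2.1.le.trans hH') hKK
      · exact ⟨K₁, H₁, e₁, hp₁, hH₁.trans (hp'.2.2.1.le.trans hH'), heH₁, heK₁, hve₁, hue₁, h4⟩
      · exact absurd (h4.trans hH₁) (hp'.2.2.1.trans_le hH').not_ge
    · exact ⟨K', H', e, hp', hH', heH, heK, hve, hue,
        (h.isCut_orth hB hp'.1 _ _ hp).resolve_left hKK⟩
  have heperp : e ∉ B.orthogonal H := fun hn =>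
    one_ne_zero (hue.symm.trans ((mem_orth' hB).1 huH e hn))
  have hK'eq : K' = B.orthogonal H := by
    refine le_antisymm (le_orth_comm hB hHK) ?_
    exact (h.isCut_orth hB hp.2.1 _ _ hp').resolve_right fun hle => heperp (hle heH)
  obtain ⟨A, hA, hA', hAs⟩ := h.exists_dual hB hp' (by rw [hK'eq, closure_orth hB])
  have hHA : H ≤ A := by
    rcases hA' with rfl | hA'
    · exact hHK
    · refine (hg.isCut hA' _ _ hp).resolve_left fun hle => heK ?_
      exact hA.le (orth_anti hle (hH' heH))
  have heK' : e ∈ K := hco (hH' heH)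
  have := hU.wedge_isotropic hB hA heK (hAs e heH) (hHA hv) (mem_orth.1 (hH' heH) e heK')
    (by rw [hB.eq, hve]) hu
  rw [wedge_apply, hue, one_smul] at this
  simpa using U.sub_mem (U.smul_mem (B u v) (hKU heK')) this

theorem exists_of_dependent {a b : V} {s t : ℂ} (hst : s • a + t • b ∈ K)
    (h0 : ¬(s = 0 ∧ t = 0)) (hsp : ∀ x ∈ H, ∃ p q : ℂ, x - (p • a + q • b) ∈ K) :
    ∃ c : V, ∀ x ∈ H, ∃ r : ℂ, x - r • c ∈ K := by
  by_cases hs : s = 0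
  · have ht : t ≠ 0 := fun ht => h0 ⟨hs, ht⟩
    refine ⟨a, fun x hx => ?_⟩
    obtain ⟨p, q, hpq⟩ := hsp x hx
    refine ⟨p - q * t⁻¹ * s, ?_⟩
    convert K.add_mem hpq (K.smul_mem (q * t⁻¹) hst) using 1
    rw [smul_add, smul_smul, smul_smul, mul_assoc, mul_assoc, inv_mul_cancel₀ ht]
    module
  · refine ⟨b, fun x hx => ?_⟩
    obtain ⟨p, q, hpq⟩ := hsp x hx
    refine ⟨q - p * s⁻¹ * t, ?_⟩
    convert K.add_mem hpq (K.smul_mem (p * s⁻¹) hst) using 1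
    rw [smul_add, smul_smul, smul_smul, mul_assoc, mul_assoc, inv_mul_cancel₀ hs]
    module

/-- Nonisotropic vectors orthogonal to two given nonisotropic orthogonal vectors. -/
theorem exists_nonisotropic (hB : B.IsSymm) (hK : B.orthogonal H ≤ K) {x w : V}
    (hx : x ∈ H) (hw : w ∈ H) (hxw : B x w = 0) (hxx : B x x ≠ 0) (hww : B w w ≠ 0)
    (h3 : ∃ h ∈ H, ∀ s t : ℂ, h - (s • x + t • w) ∉ K) :
    ∃ g ∈ H, B g x = 0 ∧ B g w = 0 ∧ B g g ≠ 0 := by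
  have hwx : B w x = 0 := by rw [hB.eq, hxw]
  have proj : ∀ h ∈ H, ∃ s t : ℂ, h - (s • x + t • w) ∈ H ∧ B (h - (s • x + t • w)) x = 0 ∧
      B (h - (s • x + t • w)) w = 0 := by
    intro h hh
    refine ⟨B h x / B x x, B h w / B w w, ?_, ?_, ?_⟩
    · exact H.sub_mem hh (H.add_mem (H.smul_mem _ hx) (H.smul_mem _ hw))
    · simp [hwx, hxx]
    · simp [hxw, hww]
  obtain ⟨h, hh, hhK⟩ := h3
  obtain ⟨s, t, h1, h2, h3⟩ := proj h hh
  have h4 := hhK s t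
  generalize h - (s • x + t • w) = g at h1 h2 h3 h4
  by_cases hgg : B g g = 0
  swap
  · exact ⟨g, h1, h2, h3, hgg⟩
  -- If `g` and a partner `k'` with ⟨g, k'⟩ = 1 are both isotropic, then `g + k'` has square 2.
  obtain ⟨k, hk, hgk⟩ := exists_eq_one hB hK h4
  obtain ⟨s, t, k1, k2, k3⟩ := proj k hk
  have hgk' : B g (k - (s • x + t • w)) = 1 := by simp [hgk, h2, h3]
  generalize k - (s • x + t • w) = k' at k1 k2 k3 hgk'
  by_cases hkk : B k' k' = 0
  swap
  · exact ⟨k', k1, k2, k3, hkk⟩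
  refine ⟨g + k', H.add_mem h1 k1, by simp [h2, k2], by simp [h3, k3], ?_⟩
  have : B k' g = 1 := by rw [hB.eq, hgk']
  simp only [map_add, LinearMap.add_apply, hgg, hgk', this, hkk]
  norm_num

/-- Perfectness of so(H/K) in dimension at least 3, which is what `h3` says. If `x` or `w` is
isotropic, `x ∧ w` is a commutator or lowering; otherwise a nonisotropic `g` orthogonal to both
gives [g ∧ x, g ∧ w] = −⟨g, g⟩ x ∧ w. -/
theorem IsWeaklyStable.wedge_middle (hB : B.IsSymm) (h : IsSelfTaut B 𝓕)
    (hU : IsWeaklyStable B 𝓕 U) (hp : IsImmediatePair 𝓕 K H) (hHK : H ≤ B.orthogonal K)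
    (hK : B.orthogonal H = K)
    (hs : ∀ f ∈ H, ∀ y ∈ H, wedge B f y ∈ stabilizer (soInf B) 𝓕)
    (h3 : ∀ a ∈ H, ∀ b ∈ H, ∃ h ∈ H, ∀ s t : ℂ, h - (s • a + t • b) ∉ K) {x w : V} (hx : x ∈ H)
    (hw : w ∈ H) (hxw : B x w = 0) (hu : u ∈ U) : wedge B x w u ∈ U := by
  have easy : ∀ x ∈ H, ∀ w ∈ H, B x w = 0 → B x x = 0 → wedge B x w u ∈ U := by
    intro x hx w hw hxw hxx
    by_cases hxK : x ∈ K
    · exact hU.wedge_orth hB h hp.1 hxK (hHK hw) hu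
    · exact hU.wedge_isotropic hB hK hxK (hs x hx) hw hxx hxw hu
  by_cases hxx : B x x = 0
  · exact easy x hx w hw hxw hxx
  by_cases hww : B w w = 0
  · rw [wedge_swap, LinearMap.neg_apply]
    exact U.neg_mem (easy w hw x hx (by rw [hB.eq, hxw]) hww)
  obtain ⟨g, hg, hgx, hgw, hgg⟩ := exists_nonisotropic hB hK.le hx hw hxw hxx hww (h3 x hx w hw)
  have := hU.lie _ (hs g hg x hx) _ (hs g hg w hw) u hu
  rw [lie_wedge_wedge_common hB, hgx, hgw, zero_smul, zero_smul, zero_sub, sub_zero, ← neg_smul,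
    LinearMap.smul_apply] at this
  exact smul_mem_of_ne (neg_ne_zero.2 hgg) this

theorem IsWeaklyStable.le_of_pair_middle (hB : B.IsSymm) (h : IsSelfTaut B 𝓕)
    (hU : IsWeaklyStable B 𝓕 U) (hp : IsImmediatePair 𝓕 K H) (hcl : mackeyClosure B K = K)
    (hne : ¬ IsExceptional B 𝓕 K) (hKU : K ≤ U) (hu : u ∈ U) (huK : u ∉ K)
    (huH : u ∈ mackeyClosure B H) (hHK : H ≤ B.orthogonal K) (hK : B.orthogonal H = K) :
    H ≤ U := by
  have hg := h.toIsGeneralizedFlag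
  have hclH : mackeyClosure B H = B.orthogonal K := by rw [mackeyClosure, hK]
  obtain ⟨A, hA, hA', hAs⟩ := h.exists_dual hB hp hcl
  have hHA : H ≤ A := by
    rcases hA' with rfl | hA'
    · exact hHK
    · refine (hg.isCut hA' _ _ hp).resolve_left fun hle => hp.2.2.1.not_ge ?_
      exact hHK.trans ((orth_anti hle).trans hA.le)
  have hs : ∀ f ∈ H, ∀ y ∈ H, wedge B f y ∈ stabilizer (soInf B) 𝓕 :=
    fun f hf y hy => hAs f hf y (hHA hy)
  by_cases h3 : ∀ a ∈ H, ∀ b ∈ H, ∃ h ∈ H, ∀ s t : ℂ, h - (s • a + t • b) ∉ K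
  · have hw : ∀ v ∈ U, v ∉ K → ∀ x ∈ H, B v x = 0 → x ∈ U := by
      intro v hv hvK x hx hvx
      by_cases hc : ∃ c : ℂ, v - c • x ∈ K
      · exact mem_of_sub_smul_mem hKU hv hvK hc.choose_spec
      push Not at hc
      obtain ⟨w, hw, hxw, hvw⟩ := exists_orth_and_eq_one hB hK.le hc
      have := hU.wedge_middle hB h hp hHK hK hs h3 hx hw hxw hv
      rwa [wedge_apply, hvw, hvx, one_smul, zero_smul, sub_zero] at this
    intro f hf
    -- Vectors of `H` orthogonal to `u` are reached directly. Otherwise pass through an auxiliary `x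
    -- ⟂ u`: from `x` one reaches some `w` with ⟨u, w⟩ = 1, and `f − ⟨u, f⟩ w` is orthogonal to `u`.
    by_cases huf : B u f = 0
    · exact hw u hu huK f hf huf
    obtain ⟨x, hx, hxK, hux, hxu⟩ : ∃ x ∈ H, x ∉ K ∧ B u x = 0 ∧ ∀ c : ℂ, u - c • x ∉ K := by
      have hproj : ∀ k ∈ H, k - (B u k / B u f) • f ∈ H ∧ B u (k - (B u k / B u f) • f) = 0 :=
        fun k hk => ⟨H.sub_mem hk (H.smul_mem _ hf), by simp [huf]⟩
      by_cases huH' : u ∈ H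
      · obtain ⟨k, hk, hkK⟩ := h3 f hf u huH'
        refine ⟨_, (hproj k hk).1, fun hn => hkK (B u k / B u f) 0 (by simpa using hn),
          (hproj k hk).2, fun c hc => ?_⟩
        have hc0 : c ≠ 0 := by
          rintro rfl
          exact huK (by simpa using hc)
        apply hkK (B u k / B u f) c⁻¹
        convert K.smul_mem (-c⁻¹) hc using 1
        rw [smul_sub, smul_smul, neg_mul, inv_mul_cancel₀ hc0]
        module
      · obtain ⟨k, hk, hkK⟩ := h3 f hf f hf
        refine ⟨_, (hproj k hk).1, fun hn => hkK (B u k / B u f) 0 (by simpa using hn),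
          (hproj k hk).2, fun c hc => huH' ?_⟩
        simpa using H.add_mem (hp.2.2.1.le hc) (H.smul_mem c (hproj k hk).1)
    obtain ⟨w, hwH, hxw, huw⟩ := exists_orth_and_eq_one hB hK.le hxu
    have hwU := hw x (hw u hu huK x hx hux) hxK w hwH hxw
    have := hw u hu huK (f - B u f • w) (H.sub_mem hf (H.smul_mem _ hwH)) (by simp [huw])
    simpa using U.add_mem this (U.smul_mem (B u f) hwU)
  · push Not at h3
    obtain ⟨a, ha, b, hb, hsp⟩ := h3
    have hHeq : H = K ⊔ Submodule.span ℂ {a} ⊔ Submodule.span ℂ {b} := by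
      refine le_antisymm (fun x hx => ?_)
        (sup_le (sup_le hp.2.2.1.le (by simpa using ha)) (by simpa using hb))
      obtain ⟨s, t, hst⟩ := hsp x hx
      refine mem_sup_span_singleton_iff.2 ⟨t, mem_sup_span_singleton_iff.2 ⟨s, ?_⟩⟩
      convert hst using 1
      module
    -- In dimension at most 2 the space `H` is closed, so `H = Kᗮ`. Dimension 2 is excluded as
    -- exceptional, and in dimension at most 1 the vector `u` already spans `H` modulo `K`.
    have hHcl : mackeyClosure B H = H := by
      rw [hHeq, closed_sup_span_singleton hB (closed_sup_span_singleton hB hcl a)]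
    have hdep : ∃ s t : ℂ, s • a + t • b ∈ K ∧ ¬(s = 0 ∧ t = 0) := by
      by_contra! hn
      refine hne ⟨hp.1, hp.2.2.1.le.trans hHK, hcl, finrank_quotient_eq_two_iff.2
        ⟨a, hHK ha, b, hHK hb, hn, ?_⟩⟩
      rwa [← hclH, hHcl]
    obtain ⟨s, t, hst, h0⟩ := hdep
    obtain ⟨c, hc⟩ := exists_of_dependent hst h0 hsp
    obtain ⟨r, hr⟩ := hc u (hHcl ▸ huH)
    have hcU := mem_of_sub_smul_mem hKU hu huK hr
    intro f hf
    obtain ⟨q, hq⟩ := hc f hf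
    simpa using U.add_mem (hKU hq) (U.smul_mem q hcU)

theorem IsWeaklyStable.le_of_pair (hB : B.IsSymm) (h : IsSelfTaut B 𝓕) (hr : IsReduced B 𝓕)
    (hU : IsWeaklyStable B 𝓕 U) (hp : IsImmediatePair 𝓕 K H) (hcl : mackeyClosure B K = K)
    (hne : ¬ IsExceptional B 𝓕 K) (hu : u ∈ U) (huK : u ∉ K) : H ≤ U := by
  have hKU := hU.le_of_closed hB h hr hp.1 hcl hu huK
  by_cases huH : u ∈ mackeyClosure B H
  swap
  · exact (le_closure hB H).trans (hU.le_of_closed hB h hr (h.closure_mem hB hp.2.1)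
      (closure_closure hB H) hu huH)
  rcases h.isCut_orth hB hp.2.1 _ _ hp with h1 | h1
  · rcases h.isCut_orth hB hp.1 _ _ hp with h2 | h2
    · exact hU.le_of_pair_coisotropic hB h hp hcl hKU hu huK huH h2
    · exact hU.le_of_pair_middle hB h hp hcl hne hKU hu huK huH h2
        (le_antisymm h1 (le_orth_comm hB h2))
  · exact hU.le_of_pair_isotropic hB h hp hcl hKU hu huK huH h1

theorem IsImmediatePair.eq_of_left {F G G' : Submodule ℂ V} (hc : IsChain (· ≤ ·) 𝓕)
    (h : IsImmediatePair 𝓕 F G) (h' : IsImmediatePair 𝓕 F G') : G = G' := by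
  rcases hc.total h.2.1 h'.2.1 with h1 | h1
  · by_contra hne
    exact h'.2.2.2 G h.2.1 ⟨h.2.2.1, h1.lt_of_ne hne⟩
  · by_contra hne
    exact h.2.2.2 G' h'.2.1 ⟨h'.2.2.1, h1.lt_of_ne (Ne.symm hne)⟩

/-- `K` need not be closed, so each of its vectors is treated through the pair `K' < H'` catching
it. If `u` lies in the closure of `H'`, then `H'` is not closed; hence `K'` is closed, and not
exceptional since its successor would then be the closed `K'ᗮ`. -/
theorem IsWeaklyStable.lower_le (hB : B.IsSymm) (h : IsSelfTaut B 𝓕) (hr : IsReduced B 𝓕)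
    (hU : IsWeaklyStable B 𝓕 U) (hp : IsImmediatePair 𝓕 K H) (hu : u ∈ U) (huK : u ∉ K) :
    K ≤ U := by
  have hg := h.toIsGeneralizedFlag
  intro f hf
  by_cases hf0 : f = 0
  · simp [hf0]
  obtain ⟨K', H', hp', h2, h1⟩ := hg.caught f hf0
  have hH' : H' ≤ K := (hg.isCut hp.1 _ _ hp').resolve_left fun hle => h1 (hle hf)
  by_cases huH : u ∈ mackeyClosure B H'
  swap
  · exact hU.le_of_closed hB h hr (h.closure_mem hB hp'.2.1) (closure_closure hB H') hu huH
      (le_closure hB _ h2)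
  have hncl : mackeyClosure B H' ≠ H' := fun hc => huK (hH' (hc.le huH))
  refine hU.le_of_pair hB h hr hp' ?_ (fun hex => hncl ?_) hu
    (fun hn => huK (hH' (hp'.2.2.1.le hn))) h2
  · refine (h.closure_eq _ _ hp').resolve_right fun hc => hncl ?_
    rw [← hc, closure_closure hB]
  · rw [hp'.eq_of_left hg.chain (hr K' hex), closure_orth hB]

/-- Position of a weakly stable subspace with respect to the immediate pairs of a reduced flag. -/
theorem IsWeaklyStable.dichotomy (hB : B.IsSymm) (h : IsSelfTaut B 𝓕) (hr : IsReduced B 𝓕)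
    (hU : IsWeaklyStable B 𝓕 U) (hp : IsImmediatePair 𝓕 K H) :
    U ≤ K ∨ K ≤ U ∧ (mackeyClosure B K = K → ¬ IsExceptional B 𝓕 K → H ≤ U) := by
  by_cases hUK : U ≤ K
  · exact .inl hUK
  obtain ⟨u, hu, huK⟩ := SetLike.not_le_iff_exists.1 hUK
  exact .inr ⟨hU.lower_le hB h hr hp hu huK,
    fun hcl hne => hU.le_of_pair hB h hr hp hcl hne hu huK⟩

end Generation

/-! ### Flags determined by their mutual position -/

section Uniqueness

variable {V : Type*} [AddCommGroup V] [Module ℂ V] {𝓕 𝓖 : Set (Submodule ℂ V)}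
  {B : LinearMap.BilinForm ℂ V}

/-- A subspace that strictly straddles no immediate pair of `𝓕` with closed lower member. -/
def IsNearCut (B : LinearMap.BilinForm ℂ V) (𝓕 : Set (Submodule ℂ V)) (G : Submodule ℂ V) : Prop :=
  ∀ F' F'', IsImmediatePair 𝓕 F' F'' → G ≤ F' ∨ F'' ≤ G ∨ F' ≤ G ∧ mackeyClosure B F' = F''

/-- Suppose `G` straddles a pair whose upper member is the closure of `F'`. The pair of `𝓖` catching
a vector of `G` outside `F'` has its upper member inside `G`. The position of `F'` relative to the
pairs of `𝓖` then puts the closure of `F'` inside `G`, a contradiction. -/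
theorem IsNearCut.isCut (hB : B.IsSymm) (h𝓖 : IsSemiclosed B 𝓖)
    (h𝓕𝓖 : ∀ F ∈ 𝓕, IsNearCut B 𝓖 F) {G : Submodule ℂ V} (hG : G ∈ 𝓖)
    (hGc : IsNearCut B 𝓕 G) : IsCut 𝓕 G := by
  have hg := h𝓖.toIsGeneralizedFlag
  intro F' F'' hp
  by_contra! hn
  obtain ⟨-, hc⟩ := ((hGc _ _ hp).resolve_left hn.1).resolve_left hn.2
  obtain ⟨v, hv, hvF⟩ := SetLike.not_le_iff_exists.1 hn.1
  obtain ⟨G', G'', hq, hv2, hv1⟩ := hg.caught v (by rintro rfl; exact hvF F'.zero_mem)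
  have hG''G : G'' ≤ G := (hg.isCut hG _ _ hq).resolve_left fun hle => hv1 (hle hv)
  rcases h𝓕𝓖 F' hp.1 _ _ hq with h1 | h1 | ⟨h1, h2⟩
  · exact hn.2 (hc ▸ (closure_mono h1).trans ((h𝓖.closure_lower_le hq).trans hG''G))
  · exact hvF (h1 hv2)
  · have hF' : F' ≤ G'' := by
      intro w hw
      by_contra hwG
      obtain ⟨A, C, hr, hw2, hw1⟩ := hg.caught w (by rintro rfl; exact hwG G''.zero_mem)
      have hA : G'' ≤ A := (hg.isCut hq.2.1 _ _ hr).resolve_right fun hle => hwG (hle hw2)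
      rcases h𝓕𝓖 F' hp.1 _ _ hr with h3 | h3 | ⟨h3, -⟩
      · exact hw1 (h3 hw)
      · exact hvF (h3 (hr.2.2.1.le (hA hv2)))
      · exact hvF (h3 (hA hv2))
    refine hn.2 (hc ▸ (closure_le_of_closed ?_ hF').trans hG''G)
    rw [← h2, closure_closure hB]

theorem IsImmediatePair.of_isCut (h𝓖 : IsGeneralizedFlag 𝓖)
    (h𝓕𝓖 : ∀ F ∈ 𝓕, IsCut 𝓖 F) (h𝓖𝓕 : ∀ G ∈ 𝓖, IsCut 𝓕 G) {F' F'' : Submodule ℂ V}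
    (hp : IsImmediatePair 𝓕 F' F'') : IsImmediatePair 𝓖 F' F'' := by
  obtain ⟨v, hv2, hv1⟩ := SetLike.exists_of_lt hp.2.2.1
  obtain ⟨G', G'', hq, h1, h2, h3, h4⟩ :=
    (h𝓕𝓖 _ hp.2.1).exists_pair h𝓖 (.inr (h𝓕𝓖 _ hp.1)) hv2 hv1
  have e1 : G' = F' :=
    le_antisymm ((h𝓖𝓕 _ hq.1 _ _ hp).resolve_right fun hle => h4 (hle hv2)) h2
  have e2 : G'' = F'' :=
    le_antisymm h1 ((h𝓖𝓕 _ hq.2.1 _ _ hp).resolve_left fun hle => hv1 (hle h3))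
  rwa [e1, e2] at hq

theorem subset_of_isCut (h𝓕 : IsGeneralizedFlag 𝓕) (h𝓖 : IsGeneralizedFlag 𝓖)
    (h𝓕𝓖 : ∀ F ∈ 𝓕, IsCut 𝓖 F) (h𝓖𝓕 : ∀ G ∈ 𝓖, IsCut 𝓕 G) : 𝓕 ⊆ 𝓖 := by
  intro F hF
  rcases h𝓕.pred_or_succ F hF with ⟨G, hp⟩ | ⟨G, hp⟩
  · exact (hp.of_isCut h𝓖 h𝓕𝓖 h𝓖𝓕).2.1
  · exact (hp.of_isCut h𝓖 h𝓕𝓖 h𝓖𝓕).1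

theorem eq_of_isNearCut (hB : B.IsSymm) (h𝓕 : IsSemiclosed B 𝓕) (h𝓖 : IsSemiclosed B 𝓖)
    (h𝓕𝓖 : ∀ F ∈ 𝓕, IsNearCut B 𝓖 F) (h𝓖𝓕 : ∀ G ∈ 𝓖, IsNearCut B 𝓕 G) : 𝓕 = 𝓖 := by
  have h1 : ∀ F ∈ 𝓕, IsCut 𝓖 F := fun F hF => (h𝓕𝓖 F hF).isCut hB h𝓕 h𝓖𝓕 hF
  have h2 : ∀ G ∈ 𝓖, IsCut 𝓕 G := fun G hG => (h𝓖𝓕 G hG).isCut hB h𝓖 h𝓕𝓖 hG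
  have g1 := h𝓕.toIsGeneralizedFlag
  have g2 := h𝓖.toIsGeneralizedFlag
  exact (subset_of_isCut g1 g2 h1 h2).antisymm (subset_of_isCut g2 g1 h2 h1)

variable {U U₁ U₂ : Submodule ℂ V}

theorem IsWeaklyStable.isNearCut (hB : B.IsSymm) (h : IsSelfTaut B 𝓕) (hr : IsReduced B 𝓕)
    (hU : IsWeaklyStable B 𝓕 U)
    (hex : ∀ L, IsExceptional B 𝓕 L → U ≤ L ∨ B.orthogonal L ≤ U) : IsNearCut B 𝓕 U := by
  intro F' F'' hp
  by_cases hUF : U ≤ F'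
  · exact .inl hUF
  obtain ⟨h1, h2⟩ := (hU.dichotomy hB h hr hp).resolve_left hUF
  right
  rcases h.closure_eq _ _ hp with hc | hc
  swap
  · exact .inr ⟨h1, hc⟩
  left
  by_cases he : IsExceptional B 𝓕 F'
  · have hpair := hr _ he
    rw [hp.eq_of_left h.chain hpair]
    refine (hex _ he).resolve_left fun hle => ?_
    exact hUF hle
  · exact h2 hc he

/-- Vectors witnessing incomparability are caught by one and the same pair. If its lower member were
closed and not exceptional, or had the upper member as closure, then `U₁` would contain both
vectors. -/
theorem exists_isExceptional_le (hB : B.IsSymm) (h : IsSelfTaut B 𝓕) (hr : IsReduced B 𝓕)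
    (hU₁ : IsWeaklyStable B 𝓕 U₁) (hU₂ : IsWeaklyStable B 𝓕 U₂) (hc₁ : mackeyClosure B U₁ = U₁)
    (h12 : ¬ U₁ ≤ U₂) (h21 : ¬ U₂ ≤ U₁) : ∃ L, IsExceptional B 𝓕 L ∧ L ≤ U₁ ∧ L ≤ U₂ := by
  have hg := h.toIsGeneralizedFlag
  obtain ⟨v, hv1, hv2⟩ := SetLike.not_le_iff_exists.1 h12
  obtain ⟨w, hw2, hw1⟩ := SetLike.not_le_iff_exists.1 h21
  obtain ⟨F', F'', hp, hvF, hvF'⟩ := hg.caught v (by rintro rfl; exact hv2 U₂.zero_mem)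
  obtain ⟨C', C'', hq, hwC, hwC'⟩ := hg.caught w (by rintro rfl; exact hw1 U₁.zero_mem)
  have a1 := (hU₁.dichotomy hB h hr hp).resolve_left fun hle => hvF' (hle hv1)
  have a2 := (hU₂.dichotomy hB h hr hq).resolve_left fun hle => hwC' (hle hw2)
  have b1 : C'' ≤ F'' :=
    (hg.isCut hp.2.1 _ _ hq).resolve_left fun hle => hv2 (a2.1 (hle hvF))
  have b2 : F'' ≤ C'' :=
    (hg.isCut hq.2.1 _ _ hp).resolve_left fun hle => hw1 (a1.1 (hle hwC))
  obtain rfl := le_antisymm b1 b2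
  have b3 : C' ≤ F' := (hg.isCut hq.1 _ _ hp).resolve_right hq.2.2.1.not_ge
  have b4 : F' ≤ C' := (hg.isCut hp.1 _ _ hq).resolve_right hp.2.2.1.not_ge
  obtain rfl := le_antisymm b3 b4
  refine ⟨C', ?_, a1.1, a2.1⟩
  rcases h.closure_eq _ _ hp with hc | hc
  · by_contra hne
    exact hw1 (a1.2 hc hne hwC)
  · exact absurd (closure_le_of_closed hc₁ a1.1 (hc ▸ hwC)) hw1

end Uniqueness

/-! ### The hyperbolic plane Lᗮ / L and the flags around it -/

section Exceptional

variable {V : Type*} [AddCommGroup V] [Module ℂ V] {𝓕 : Set (Submodule ℂ V)}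
  {B : LinearMap.BilinForm ℂ V} {L K : Submodule ℂ V} {a b : V}

theorem exists_combination {P K : Submodule ℂ V}
    (h2 : Module.finrank ℂ (P ⧸ K.submoduleOf P) = 2) (ha : a ∈ P) (hb : b ∈ P)
    (hli : ∀ s t : ℂ, s • a + t • b ∈ K → s = 0 ∧ t = 0) {x : V} (hx : x ∈ P) :
    ∃ s t : ℂ, x - (s • a + t • b) ∈ K := by
  have : FiniteDimensional ℂ (P ⧸ K.submoduleOf P) := FiniteDimensional.of_finrank_pos (by omega)
  let q := (K.submoduleOf P).mkQ
  have hl : LinearIndependent ℂ ![q ⟨a, ha⟩, q ⟨b, hb⟩] := by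
    rw [LinearIndependent.pair_iff]
    intro s t hst
    rw [← map_smul, ← map_smul, ← map_add, Submodule.mkQ_apply,
      Submodule.Quotient.mk_eq_zero] at hst
    exact hli s t hst
  have hs := hl.span_eq_top_of_card_eq_finrank' (by simp [h2])
  have hxs : q ⟨x, hx⟩ ∈ Submodule.span ℂ (Set.range ![q ⟨a, ha⟩, q ⟨b, hb⟩]) :=
    hs ▸ Submodule.mem_top
  rw [Matrix.range_cons, Matrix.range_cons, Matrix.range_empty, Set.union_empty,
    Set.singleton_union, Submodule.mem_span_pair] at hxs
  obtain ⟨s, t, hst⟩ := hxs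
  rw [← map_smul, ← map_smul, ← map_add, eq_comm] at hst
  exact ⟨s, t, (Submodule.Quotient.eq (K.submoduleOf P)).1 hst⟩

/-- `a` and `b` represent a hyperbolic basis of `Lᗮ / L`. -/
structure IsHyperbolicPair (B : LinearMap.BilinForm ℂ V) (L : Submodule ℂ V) (a b : V) : Prop where
  left_mem : a ∈ B.orthogonal L
  right_mem : b ∈ B.orthogonal L
  left_self : B a a = 0
  right_self : B b b = 0
  left_right : B a b = 1
  right_left : B b a = 1
  sub_mem : ∀ x ∈ B.orthogonal L, x - (B x b • a + B x a • b) ∈ L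

theorem IsHyperbolicPair.symm (h : IsHyperbolicPair B L a b) : IsHyperbolicPair B L b a where
  left_mem := h.right_mem
  right_mem := h.left_mem
  left_self := h.right_self
  right_self := h.left_self
  left_right := h.right_left
  right_left := h.left_right
  sub_mem x hx := add_comm (B x b • a) _ ▸ h.sub_mem x hx

theorem hyperbolic_independent (ha : a ∈ B.orthogonal L) (hb : b ∈ B.orthogonal L)
    (haa : B a a = 0) (hbb : B b b = 0) (hab : B a b = 1) (hba : B b a = 1) (s t : ℂ)
    (hst : s • a + t • b ∈ L) : s = 0 ∧ t = 0 := by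
  constructor
  · simpa [hab, hbb] using mem_orth.1 hb _ hst
  · simpa [hba, haa] using mem_orth.1 ha _ hst

theorem IsExceptional.exists_hyperbolic (hB : B.IsSymm) (h : IsExceptional B 𝓕 L) :
    ∃ a b, IsHyperbolicPair B L a b := by
  obtain ⟨-, hiso, hcl, h2⟩ := h
  obtain ⟨a, ha, haL, haa⟩ : ∃ a ∈ B.orthogonal L, a ∉ L ∧ B a a = 0 := by
    obtain ⟨p, hp, q, hq, hli, -⟩ := finrank_quotient_eq_two_iff.1 h2
    by_cases hpp : B p p = 0
    · exact ⟨p, hp, fun hn => one_ne_zero (hli 1 0 (by simpa using hn)).1, hpp⟩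
    -- The equation ⟨zp + q, zp + q⟩ = 0 is quadratic in `z`; its discriminant has a square root in
    -- ℂ.
    obtain ⟨s, hs⟩ := IsAlgClosed.exists_pow_nat_eq (discrim (B p p) (2 * B p q) (B q q))
      (n := 2) (by norm_num)
    obtain ⟨z, hz⟩ := exists_quadratic_eq_zero hpp ⟨s, by rw [← hs, sq]⟩
    refine ⟨z • p + q, Submodule.add_mem _ (Submodule.smul_mem _ _ hp) hq,
      fun hn => one_ne_zero (hli z 1 (by simpa using hn)).2, ?_⟩
    simp only [map_add, map_smul, LinearMap.add_apply, LinearMap.smul_apply, smul_eq_mul]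
    rw [hB.eq q p, ← hz]
    ring
  obtain ⟨c, hc, hac⟩ := exists_eq_one hB hcl.le haL
  have hca : B c a = 1 := by rw [hB.eq, hac]
  -- The multiple of `a` cancels ⟨c, c⟩ without changing the pairing with `a`.
  refine ⟨a, c - (B c c / 2) • a, ?_⟩
  have hb : c - (B c c / 2) • a ∈ B.orthogonal L :=
    Submodule.sub_mem _ hc (Submodule.smul_mem _ _ ha)
  have hab : B a (c - (B c c / 2) • a) = 1 := by simp [hac, haa]
  have hba : B (c - (B c c / 2) • a) a = 1 := by rw [hB.eq, hab]
  have hbb : B (c - (B c c / 2) • a) (c - (B c c / 2) • a) = 0 := by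
    simp only [map_sub, map_smul, LinearMap.sub_apply, LinearMap.smul_apply, smul_eq_mul, haa, hac,
      hca]
    ring
  generalize c - (B c c / 2) • a = b at hb hab hba hbb
  refine ⟨ha, hb, haa, hbb, hab, hba, fun x hx => ?_⟩
  obtain ⟨s, t, hst⟩ := exists_combination h2 ha hb
    (hyperbolic_independent ha hb haa hbb hab hba) hx
  have h1 : B x b = s := by simpa [hab, hbb, sub_eq_zero] using mem_orth.1 hb _ hst
  have h2 : B x a = t := by simpa [haa, hba, sub_eq_zero] using mem_orth.1 ha _ hst
  rwa [h1, h2]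

theorem IsHyperbolicPair.mem_sup_iff (h : IsHyperbolicPair B L a b) (hL : IsIsotropic B L) {x : V} :
    x ∈ L ⊔ Submodule.span ℂ {a} ↔ x ∈ B.orthogonal L ∧ B x a = 0 := by
  rw [mem_sup_span_singleton_iff]
  constructor
  · rintro ⟨c, hc⟩
    refine ⟨?_, ?_⟩
    · simpa using Submodule.add_mem _ (hL hc) (Submodule.smul_mem _ c h.left_mem)
    · simpa [h.left_self] using mem_orth.1 h.left_mem _ hc
  · rintro ⟨hx, hxa⟩
    exact ⟨B x b, by simpa [hxa] using h.sub_mem x hx⟩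

theorem IsHyperbolicPair.orth_sup (hB : B.IsSymm) (h : IsHyperbolicPair B L a b)
    (hL : IsIsotropic B L) :
    B.orthogonal (L ⊔ Submodule.span ℂ {a}) = L ⊔ Submodule.span ℂ {a} := by
  ext x
  rw [mem_orth' hB, h.mem_sup_iff hL, mem_orth' hB]
  constructor
  · exact fun hx => ⟨fun y hy => hx y (Submodule.mem_sup_left hy),
      hx a (Submodule.mem_sup_right (Submodule.mem_span_singleton_self a))⟩
  · rintro ⟨h1, h2⟩ y hy
    obtain ⟨c, hc⟩ := mem_sup_span_singleton_iff.1 hy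
    simpa [h2] using h1 _ hc

theorem left_mem_sup : a ∈ L ⊔ Submodule.span ℂ {a} :=
  Submodule.mem_sup_right (Submodule.mem_span_singleton_self a)

theorem IsHyperbolicPair.right_notMem (h : IsHyperbolicPair B L a b) (hL : IsIsotropic B L) :
    b ∉ L ⊔ Submodule.span ℂ {a} := by
  rw [h.mem_sup_iff hL, h.right_left]
  exact fun hn => one_ne_zero hn.2

theorem IsHyperbolicPair.left_notMem (h : IsHyperbolicPair B L a b) : a ∉ L := fun hn => by
  simpa [h.left_right] using mem_orth.1 h.right_mem a hn

theorem IsHyperbolicPair.lt_sup (h : IsHyperbolicPair B L a b) : L < L ⊔ Submodule.span ℂ {a} :=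
  le_sup_left.lt_of_not_ge fun hle => h.left_notMem (hle left_mem_sup)

theorem IsHyperbolicPair.sup_lt (h : IsHyperbolicPair B L a b) (hL : IsIsotropic B L) :
    L ⊔ Submodule.span ℂ {a} < B.orthogonal L :=
  lt_of_le_of_ne (fun _ hx => ((h.mem_sup_iff hL).1 hx).1)
    fun hn => h.right_notMem hL (hn ▸ h.right_mem)

theorem IsHyperbolicPair.sup_not_le (h : IsHyperbolicPair B L a b) (hL : IsIsotropic B L) :
    ¬ L ⊔ Submodule.span ℂ {a} ≤ L ⊔ Submodule.span ℂ {b} :=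
  fun hle => h.symm.right_notMem hL (hle left_mem_sup)

theorem IsHyperbolicPair.orth_le (h : IsHyperbolicPair B L a b) {F : Submodule ℂ V} (hF : L ≤ F)
    (ha : a ∈ F) (hb : b ∈ F) : B.orthogonal L ≤ F := by
  intro x hx
  simpa using F.add_mem (hF (h.sub_mem x hx)) (F.add_mem (F.smul_mem (B x b) ha)
    (F.smul_mem (B x a) hb))

/-- In hyperbolic coordinates the form on `Lᗮ / L` is st' + ts', so an isotropic subspace lies in
one of the two coordinate lines. -/
theorem IsHyperbolicPair.isotropic_le (hB : B.IsSymm) (h : IsHyperbolicPair B L a b)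
    (hL : IsIsotropic B L) {N : Submodule ℂ V} (hN : IsIsotropic B N) (hLN : L ≤ N) :
    N ≤ L ⊔ Submodule.span ℂ {a} ∨ N ≤ L ⊔ Submodule.span ℂ {b} := by
  have hNL : N ≤ B.orthogonal L := hN.trans (orth_anti hLN)
  have hBN : ∀ x ∈ N, ∀ y ∈ N, B x b * B y a + B x a * B y b = 0 := by
    intro x hx y hy
    have h1 := mem_orth.1 (hNL hy) _ (h.sub_mem x (hNL hx))
    rw [map_sub, LinearMap.sub_apply, mem_orth.1 (hN hy) x hx] at h1
    simp only [map_add, map_smul, LinearMap.add_apply, LinearMap.smul_apply, smul_eq_mul] at h1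
    rw [hB.eq a y, hB.eq b y] at h1
    linear_combination -h1
  by_cases hall : ∀ x ∈ N, B x a = 0
  · exact .inl fun x hx => (h.mem_sup_iff hL).2 ⟨hNL hx, hall x hx⟩
  right
  push Not at hall
  obtain ⟨x, hx, hxa⟩ := hall
  have hxb : B x b = 0 := by
    have := hBN x hx x hx
    have h2 : B x a * B x b = 0 := by linear_combination this / 2
    exact (mul_eq_zero.1 h2).resolve_left hxa
  intro y hy
  refine (h.symm.mem_sup_iff hL).2 ⟨hNL hy, ?_⟩
  have := hBN x hx y hy
  rw [hxb, zero_mul, zero_add] at this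
  exact (mul_eq_zero.1 this).resolve_left hxa

theorem IsHyperbolicPair.maximal_sup (hB : B.IsSymm) (h : IsHyperbolicPair B L a b)
    (hL : IsIsotropic B L) : Maximal (IsIsotropic B) (L ⊔ Submodule.span ℂ {a}) := by
  refine ⟨(h.orth_sup hB hL).ge, fun N hN hle => ?_⟩
  rw [← h.orth_sup hB hL]
  exact (show N ≤ B.orthogonal N from hN).trans (orth_anti hle)

theorem IsHyperbolicPair.maximal_isotropic_eq (hB : B.IsSymm) (h : IsHyperbolicPair B L a b)
    (hL : IsIsotropic B L) : {N | Maximal (IsIsotropic B) N ∧ L ≤ N} =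
      {L ⊔ Submodule.span ℂ {a}, L ⊔ Submodule.span ℂ {b}} := by
  ext N
  simp only [Set.mem_ofPred_eq, Set.mem_insert_iff, Set.mem_singleton_iff]
  constructor
  · rintro ⟨hN, hLN⟩
    rcases h.isotropic_le hB hL hN.1 hLN with h1 | h1
    · exact .inl (hN.eq_of_le (h.maximal_sup hB hL).1 h1)
    · exact .inr (hN.eq_of_le (h.symm.maximal_sup hB hL).1 h1)
  · rintro (rfl | rfl)
    · exact ⟨h.maximal_sup hB hL, le_sup_left⟩
    · exact ⟨h.symm.maximal_sup hB hL, le_sup_left⟩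

theorem eq_sup_of_le {F : Submodule ℂ V} (hLF : L < F) (hF : F ≤ L ⊔ Submodule.span ℂ {a}) :
    F = L ⊔ Submodule.span ℂ {a} := by
  obtain ⟨x, hx, hxL⟩ := SetLike.exists_of_lt hLF
  refine le_antisymm hF (sup_le hLF.le ?_)
  obtain ⟨c, hc⟩ := mem_sup_span_singleton_iff.1 (hF hx)
  have := mem_of_sub_smul_mem hLF.le hx hxL hc
  simpa using this

/-- A member of a self-taut flag strictly between `L` and `Lᗮ` is one of the two maximal isotropic
subspaces containing `L`. -/
theorem IsHyperbolicPair.eq_of_lt_of_lt (hB : B.IsSymm) (h : IsHyperbolicPair B L a b)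
    (hL : IsIsotropic B L) (h𝓕 : IsSelfTaut B 𝓕) {F : Submodule ℂ V} (hF : F ∈ 𝓕) (hLF : L < F)
    (hFL : F < B.orthogonal L) :
    F = L ⊔ Submodule.span ℂ {a} ∨ F = L ⊔ Submodule.span ℂ {b} := by
  suffices hiso : IsIsotropic B F from
    (h.isotropic_le hB hL hiso hLF.le).imp (eq_sup_of_le hLF) (eq_sup_of_le hLF)
  by_contra hiso
  have hco := (h𝓕.le_orth_or hB hF).resolve_left hiso
  have hnab : ¬ (a ∈ F ∧ b ∈ F) := fun hn => hFL.not_ge (h.orth_le hLF.le hn.1 hn.2)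
  have hcomb : ∀ x ∈ F, B x b • a + B x a • b ∈ F := fun x hx => by
    simpa using F.sub_mem hx (hLF.le (h.sub_mem x (hFL.le hx)))
  -- By Cramer's rule a nonzero determinant would put both `a` and `b` into `F`.
  have hdet : ∀ x ∈ F, ∀ y ∈ F, B x b * B y a - B x a * B y b = 0 := by
    intro x hx y hy
    by_contra hd
    refine hnab ⟨smul_mem_of_ne hd ?_, smul_mem_of_ne hd ?_⟩
    · convert F.sub_mem (F.smul_mem (B y a) (hcomb x hx)) (F.smul_mem (B x a) (hcomb y hy)) using 1
      module
    · convert F.sub_mem (F.smul_mem (B x b) (hcomb y hy)) (F.smul_mem (B y b) (hcomb x hx)) using 1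
      module
  obtain ⟨x, hx, hxL⟩ := SetLike.exists_of_lt hLF
  -- the reflection of `x` is orthogonal to `F`
  have hyF : B x b • a - B x a • b ∈ F := by
    refine hco ((mem_orth' hB).2 fun z hz => ?_)
    simp only [map_sub, map_smul, LinearMap.sub_apply, LinearMap.smul_apply, smul_eq_mul]
    rw [hB.eq a z, hB.eq b z]
    exact hdet x hx z hz
  have ha2 : (2 * B x b) • a ∈ F := by
    convert F.add_mem (hcomb x hx) hyF using 1
    module
  have hb2 : (2 * B x a) • b ∈ F := by
    convert F.sub_mem (hcomb x hx) hyF using 1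
    module
  have hx0 : ¬ (B x b = 0 ∧ B x a = 0) := fun hn =>
    hxL (by simpa [hn.1, hn.2] using h.sub_mem x (hFL.le hx))
  have fin : ∀ {a b : V}, IsHyperbolicPair B L a b → (∀ z ∈ F, B z a = 0) → False := by
    intro a b h hz
    have hFM : F ≤ L ⊔ Submodule.span ℂ {a} :=
      fun z hzF => (h.mem_sup_iff hL).2 ⟨hFL.le hzF, hz z hzF⟩
    exact hiso (hFM.trans ((h.orth_sup hB hL).ge.trans (orth_anti hFM)))
  by_cases hxa : B x a = 0
  · refine fin h fun z hz => ?_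
    have := hdet x hx z hz
    rw [hxa, zero_mul, sub_zero] at this
    exact (mul_eq_zero.1 this).resolve_left fun hn => hx0 ⟨hn, hxa⟩
  · by_cases hxb : B x b = 0
    · refine fin h.symm fun z hz => ?_
      have := hdet x hx z hz
      rw [hxb, zero_mul, zero_sub, neg_eq_zero] at this
      exact (mul_eq_zero.1 this).resolve_left hxa
    · exact hnab ⟨smul_mem_of_ne (mul_ne_zero two_ne_zero hxb) ha2,
        smul_mem_of_ne (mul_ne_zero two_ne_zero hxa) hb2⟩

/-- Were `Lᗮ` missing, the pairs catching `a` and `b` would have the two incomparable Lagrangian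
subspaces over `L` as upper members. -/
theorem IsHyperbolicPair.orth_mem (hB : B.IsSymm) (h : IsHyperbolicPair B L a b)
    (hL : IsIsotropic B L) (h𝓕 : IsSelfTaut B 𝓕) (hL𝓕 : L ∈ 𝓕) : B.orthogonal L ∈ 𝓕 := by
  have hg := h𝓕.toIsGeneralizedFlag
  by_contra hn
  have key : ∀ {a b : V}, IsHyperbolicPair B L a b → L ⊔ Submodule.span ℂ {a} ∈ 𝓕 := by
    intro a b h
    obtain ⟨F', F'', hp, h1, h2, h3, -⟩ :=
      (h𝓕.isCut_orth hB hL𝓕).exists_pair hg (.inl hL𝓕) h.left_mem h.left_notMem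
    have hlt : F'' < B.orthogonal L := h1.lt_of_ne fun he => hn (he ▸ hp.2.1)
    rcases h.eq_of_lt_of_lt hB hL h𝓕 hp.2.1 (h2.trans_lt hp.2.2.1) hlt with he | he
    · exact he ▸ hp.2.1
    · exact absurd (he ▸ h3) (h.symm.right_notMem hL)
  rcases hg.chain.total (key h) (key h.symm) with h1 | h1
  · exact h.sup_not_le hL h1
  · exact h.symm.sup_not_le hL h1

/-- If `K ≤ L`, a hyperbolic pair for `L` also represents a basis of `Kᗮ / K`; a vector of `L` is
orthogonal to both, so its coordinates vanish and it lies in `K`. -/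
theorem IsExceptional.eq (hB : B.IsSymm) (hc : IsChain (· ≤ ·) 𝓕) (hL : IsExceptional B 𝓕 L)
    (hK : IsExceptional B 𝓕 K) : K = L := by
  have key : ∀ {K L : Submodule ℂ V}, IsExceptional B 𝓕 L → IsExceptional B 𝓕 K → K ≤ L →
      L ≤ K := by
    intro K L hL hK hle x hx
    obtain ⟨a, b, h⟩ := hL.exists_hyperbolic hB
    have ha := orth_anti hle h.left_mem
    have hb := orth_anti hle h.right_mem
    obtain ⟨s, t, hst⟩ := exists_combination hK.2.2.2 ha hb
      (hyperbolic_independent ha hb h.left_self h.right_self h.left_right h.right_left)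
      (orth_anti hle (hL.2.1 hx))
    have h1 : B x a = 0 := mem_orth.1 h.left_mem x hx
    have h2 : B x b = 0 := mem_orth.1 h.right_mem x hx
    have hs : s = 0 := by
      simpa [h2, h.left_right, h.right_self] using mem_orth.1 hb _ hst
    have ht : t = 0 := by
      simpa [h1, h.right_left, h.left_self] using mem_orth.1 ha _ hst
    simpa [hs, ht] using hst
  rcases hc.total hK.1 hL.1 with h1 | h1
  · exact h1.antisymm (key hL hK h1)
  · exact (key hK hL h1).antisymm h1

theorem IsImmediatePair.congr {𝓖 : Set (Submodule ℂ V)} {M : Submodule ℂ V}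
    (h : ∀ G, G ≤ L ∨ M ≤ G → (G ∈ 𝓕 ↔ G ∈ 𝓖)) {F' F'' : Submodule ℂ V}
    (hout : F'' ≤ L ∨ M ≤ F') (hp : IsImmediatePair 𝓕 F' F'') : IsImmediatePair 𝓖 F' F'' := by
  refine ⟨(h _ ?_).1 hp.1, (h _ ?_).1 hp.2.1, hp.2.2.1, fun G hG hlt => ?_⟩
  · exact hout.imp hp.2.2.1.le.trans id
  · exact hout.imp id fun hle => hle.trans hp.2.2.1.le
  · exact hp.2.2.2 G ((h _ (hout.imp hlt.2.le.trans fun hle => hle.trans hlt.1.le)).2 hG) hlt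

/-- Replacing the members of a self-taut flag strictly between a closed isotropic member `L` and
`Lᗮ` by at most one subspace `M = Mᗮ`. -/
theorem IsSelfTaut.truncation_union (hB : B.IsSymm) (h : IsSelfTaut B 𝓕) (hL : L ∈ 𝓕)
    (hL' : B.orthogonal L ∈ 𝓕) (hcl : mackeyClosure B L = L) (hlt : L < B.orthogonal L)
    {S : Set (Submodule ℂ V)} (hS : S.Subsingleton)
    (hSM : ∀ M ∈ S, L < M ∧ M < B.orthogonal L ∧ B.orthogonal M = M) :
    IsSelfTaut B (truncation B 𝓕 L ∪ S) := by
  have hg := h.toIsGeneralizedFlag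
  set 𝓧 := truncation B 𝓕 L ∪ S with h𝓧
  have hagree : ∀ G, G ≤ L ∨ B.orthogonal L ≤ G → (G ∈ 𝓕 ↔ G ∈ 𝓧) := by
    intro G hG
    refine ⟨fun hm => .inl ⟨hm, hG⟩, ?_⟩
    rintro (hm | hm)
    · exact hm.1
    · exact absurd hG (not_or.2 ⟨(hSM G hm).1.not_ge, (hSM G hm).2.1.not_ge⟩)
  have hagree' : ∀ G, G ≤ L ∨ B.orthogonal L ≤ G → (G ∈ 𝓧 ↔ G ∈ 𝓕) :=
    fun G hG => (hagree G hG).symm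
  have hLX : L ∈ 𝓧 := (hagree _ (.inl le_rfl)).1 hL
  have hLX' : B.orthogonal L ∈ 𝓧 := (hagree _ (.inr le_rfl)).1 hL'
  have hchain : IsChain (· ≤ ·) 𝓧 := by
    have hMT : ∀ M ∈ S, ∀ F ∈ truncation B 𝓕 L, F ≤ M ∨ M ≤ F := by
      intro M hM F hF
      exact hF.2.imp (fun hle => hle.trans (hSM M hM).1.le) ((hSM M hM).2.1.le.trans ·)
    rintro F (hF | hF) G (hG | hG) hne
    · exact hg.chain hF.1 hG.1 hne
    · exact hMT G hG F hF
    · exact (hMT F hF G hG).symm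
    · exact absurd (hS hF hG) hne
  -- an immediate pair of a chain containing `L` and `Lᗮ` lies below, above or between them
  have hpos : ∀ F' F'', IsImmediatePair 𝓧 F' F'' →
      (F'' ≤ L ∨ B.orthogonal L ≤ F') ∨ L ≤ F' ∧ F'' ≤ B.orthogonal L := by
    intro F' F'' hp
    have aux : ∀ D ∈ 𝓧, D ≤ F' ∨ F'' ≤ D := by
      intro D hD
      by_contra! hn
      refine hp.2.2.2 D hD ⟨?_, ?_⟩
      · exact ((hchain.total hD hp.1).resolve_left hn.1).lt_of_not_ge hn.1
      · exact ((hchain.total hD hp.2.1).resolve_right hn.2).lt_of_not_ge hn.2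
    rcases aux L hLX with h1 | h1
    · rcases aux _ hLX' with h2 | h2
      · exact .inl (.inr h2)
      · exact .inr ⟨h1, h2⟩
    · exact .inl (.inl h1)
  have hbetween : ∀ F ∈ 𝓧, L ≤ F → F ≤ B.orthogonal L → F = L ∨ F = B.orthogonal L ∨ F ∈ S := by
    rintro F (hF | hF) h1 h2
    · exact hF.2.imp (fun h3 => h3.antisymm h1) fun h3 => .inl (h2.antisymm h3)
    · exact .inr (.inr hF)
  have hinner : (S = ∅ ∧ IsImmediatePair 𝓧 L (B.orthogonal L)) ∨
      ∃ M ∈ S, IsImmediatePair 𝓧 L M ∧ IsImmediatePair 𝓧 M (B.orthogonal L) := by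
    rcases hS.eq_empty_or_singleton with hS0 | ⟨M, hS1⟩
    · refine .inl ⟨hS0, hLX, hLX', hlt, fun G hG hn => ?_⟩
      rcases hbetween G hG hn.1.le hn.2.le with h1 | h1 | h1
      · exact hn.1.ne' h1
      · exact hn.2.ne h1
      · simp [hS0] at h1
    · have hM : M ∈ S := hS1 ▸ rfl
      have hall : ∀ G ∈ 𝓧, L < G → G < B.orthogonal L → G = M := by
        intro G hG h1 h2
        rcases hbetween G hG h1.le h2.le with h3 | h3 | h3
        · exact absurd h3 h1.ne'
        · exact absurd h3 h2.ne
        · exact hS h3 hM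
      obtain ⟨h1, h2, -⟩ := hSM M hM
      refine .inr ⟨M, hM, ⟨hLX, .inr hM, h1, fun G hG hn => ?_⟩,
        ⟨.inr hM, hLX', h2, fun G hG hn => ?_⟩⟩
      · exact hn.2.ne (hall G hG hn.1 (hn.2.trans h2))
      · exact hn.1.ne' (hall G hG (h1.trans hn.1) hn.2)
  have hflag : IsGeneralizedFlag 𝓧 := by
    refine ⟨hchain, ?_, ?_⟩
    · have hLs : ∃ G, IsImmediatePair 𝓧 L G := by
        rcases hinner with ⟨-, h1⟩ | ⟨M, -, h1, -⟩
        exacts [⟨_, h1⟩, ⟨_, h1⟩]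
      have hLp : ∃ G, IsImmediatePair 𝓧 G (B.orthogonal L) := by
        rcases hinner with ⟨-, h1⟩ | ⟨M, -, -, h1⟩
        exacts [⟨_, h1⟩, ⟨_, h1⟩]
      rintro F (hF | hF)
      · by_cases h1 : F = L
        · exact .inr (h1 ▸ hLs)
        by_cases h2 : F = B.orthogonal L
        · exact .inl (h2 ▸ hLp)
        refine (hg.pred_or_succ F hF.1).imp ?_ ?_
        · rintro ⟨G, hp⟩
          refine ⟨G, hp.congr hagree (hF.2.imp id fun hle => ?_)⟩
          exact (hg.isCut hL' _ _ hp).resolve_right fun h3 => h2 (h3.antisymm hle)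
        · rintro ⟨G, hp⟩
          refine ⟨G, hp.congr hagree (hF.2.imp (fun hle => ?_) id)⟩
          exact (hg.isCut hL _ _ hp).resolve_left fun h3 => h1 (hle.antisymm h3)
      · rcases hinner with ⟨h1, -⟩ | ⟨M, hM, h1, -⟩
        · simp [h1] at hF
        · exact .inl ⟨L, hS hM hF ▸ h1⟩
    · intro v hv
      obtain ⟨F', F'', hp, h2, h1⟩ := hg.caught v hv
      by_cases hvL : v ∈ L
      · exact ⟨F', F'', hp.congr hagree (.inl ((hg.isCut hL _ _ hp).resolve_left
          fun hle => h1 (hle hvL))), h2, h1⟩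
      by_cases hvL' : v ∈ B.orthogonal L
      swap
      · exact ⟨F', F'', hp.congr hagree (.inr ((hg.isCut hL' _ _ hp).resolve_right
          fun hle => hvL' (hle h2))), h2, h1⟩
      rcases hinner with ⟨-, h3⟩ | ⟨M, -, h3, h4⟩
      · exact ⟨_, _, h3, hvL', hvL⟩
      · by_cases hvM : v ∈ M
        · exact ⟨_, _, h3, hvM, hvL⟩
        · exact ⟨_, _, h4, hvL', hvM⟩
  -- Pairs outside the interval from `L` to `Lᗮ` are pairs of `𝓕`; inside it the lower member is `L`
  -- or the self-orthogonal `M`, both closed.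
  refine isSelfTaut_of_isCut_orth ⟨hflag, fun F' F'' hp => ?_⟩ fun F hF F' F'' hp => ?_
  · rcases hpos _ _ hp with h1 | ⟨h1, h2⟩
    · exact h.closure_eq _ _ (hp.congr hagree' h1)
    · left
      rcases hbetween F' hp.1 h1 (hp.2.2.1.le.trans h2) with h3 | h3 | h3
      · rw [h3, hcl]
      · exact absurd h3 (hp.2.2.1.trans_le h2).ne
      · rw [mackeyClosure, (hSM _ h3).2.2, (hSM _ h3).2.2]
  · rcases hF with hF | hF
    · rcases hpos _ _ hp with h1 | ⟨h1, h2⟩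
      · exact h.isCut_orth hB hF.1 _ _ (hp.congr hagree' h1)
      · rcases hF.2 with h3 | h3
        · exact .inr (h2.trans (orth_anti h3))
        · exact .inl ((orth_anti h3).trans (hcl.le.trans h1))
    · rw [(hSM _ hF).2.2]
      exact hflag.isCut (.inr hF) _ _ hp

end Exceptional

/-! ### Strictly lowering operators lie in the linear nilradical -/

section Nilradical

variable {V : Type*} [AddCommGroup V] [Module ℂ V] {𝓕 : Set (Submodule ℂ V)}
  {B : LinearMap.BilinForm ℂ V}

/-- The span of the images of all products of `n` operators from `S`. -/
def iteratedImage (S : Set (Module.End ℂ V)) : ℕ → Submodule ℂ V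
  | 0 => ⊤
  | n + 1 => Submodule.span ℂ {w | ∃ X ∈ S, ∃ v ∈ iteratedImage S n, X v = w}

theorem apply_mem_iteratedImage {S : Set (Module.End ℂ V)} {X : Module.End ℂ V} (hX : X ∈ S)
    {n : ℕ} {v : V} (hv : v ∈ iteratedImage S n) : X v ∈ iteratedImage S (n + 1) :=
  Submodule.subset_span ⟨X, hX, v, hv, rfl⟩

theorem pow_apply_mem_iteratedImage (X : Module.End ℂ V) (n : ℕ) (v : V) :
    (X ^ n) v ∈ iteratedImage {X} n := by
  induction n with
  | zero => exact Submodule.mem_top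
  | succ n ih =>
    rw [pow_succ', Module.End.mul_apply]
    exact apply_mem_iteratedImage (Set.mem_singleton X) ih

theorem iteratedImage_succ_le (S : Set (Module.End ℂ V)) (n : ℕ) :
    iteratedImage S (n + 1) ≤ iteratedImage S n := by
  induction n with
  | zero => exact le_top
  | succ n ih =>
    refine Submodule.span_le.2 ?_
    rintro _ ⟨X, hX, v, hv, rfl⟩
    exact apply_mem_iteratedImage hX (ih hv)

theorem IsGeneralizedFlag.exists_pair_of_fg (h : IsGeneralizedFlag 𝓕) (W : Submodule ℂ V)
    (hW : W.FG) : W ≠ ⊥ → ∃ F' F'', IsImmediatePair 𝓕 F' F'' ∧ W ≤ F'' ∧ ¬ W ≤ F' := by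
  induction W, hW using Submodule.fg_induction with
  | singleton x =>
    intro hx
    obtain ⟨F', F'', hp, h2, h1⟩ := h.caught x (by rintro rfl; simp at hx)
    exact ⟨F', F'', hp, by simpa using h2, by simpa using h1⟩
  | sup W₁ W₂ _ _ ih₁ ih₂ =>
    intro hW
    by_cases h1 : W₁ = ⊥
    · subst h1
      rw [bot_sup_eq] at hW ⊢
      exact ih₂ hW
    by_cases h2 : W₂ = ⊥
    · subst h2
      rw [sup_bot_eq] at hW ⊢
      exact ih₁ hW
    obtain ⟨F', F'', hp, hF2, hF1⟩ := ih₁ h1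
    obtain ⟨G', G'', hq, hG2, hG1⟩ := ih₂ h2
    rcases h.chain.total hp.2.1 hq.2.1 with hle | hle
    · exact ⟨G', G'', hq, sup_le (hF2.trans hle) hG2, fun hn => hG1 (le_sup_right.trans hn)⟩
    · exact ⟨F', F'', hp, sup_le hF2 (hG2.trans hle), fun hn => hF1 (le_sup_left.trans hn)⟩

/-- A nonzero finite-dimensional image fits into the upper but not the lower member of some pair, so
applying `S` once more makes it strictly smaller. Counting starts at index 1 because stage 0 is all
of `V`. -/
theorem IsGeneralizedFlag.exists_iteratedImage_eq_bot (h : IsGeneralizedFlag 𝓕)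
    {S : Set (Module.End ℂ V)} (hS : ∀ X ∈ S, StrictlyLowers 𝓕 X) {E : Submodule ℂ V}
    [FiniteDimensional ℂ E] (hE : ∀ X ∈ S, ∀ v, X v ∈ E) : ∃ n, iteratedImage S n = ⊥ := by
  have hle : ∀ n, iteratedImage S (n + 1) ≤ E := fun n => by
    refine Submodule.span_le.2 ?_
    rintro _ ⟨X, hX, v, -, rfl⟩
    exact hE X hX v
  have hfin : ∀ n, FiniteDimensional ℂ (iteratedImage S (n + 1)) :=
    fun n => Submodule.finiteDimensional_of_le (hle n)
  have key : ∀ n, iteratedImage S (n + 1) = ⊥ ∨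
      Module.finrank ℂ (iteratedImage S (n + 1)) + n ≤ Module.finrank ℂ E := by
    intro n
    induction n with
    | zero => exact .inr (Submodule.finrank_mono (hle 0))
    | succ n ih =>
      have := hfin n
      rcases ih with h0 | h0
      · exact .inl (le_bot_iff.1 (h0 ▸ iteratedImage_succ_le S (n + 1)))
      by_cases hb : iteratedImage S (n + 1) = ⊥
      · exact .inl (le_bot_iff.1 (hb ▸ iteratedImage_succ_le S (n + 1)))
      right
      obtain ⟨F', F'', hp, h2, h1⟩ :=
        h.exists_pair_of_fg _ ((Submodule.fg_iff_finiteDimensional _).2 this) hb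
      have hlt : iteratedImage S (n + 1 + 1) < iteratedImage S (n + 1) := by
        refine (iteratedImage_succ_le S (n + 1)).lt_of_not_ge fun hge => h1 (hge.trans ?_)
        refine Submodule.span_le.2 ?_
        rintro _ ⟨X, hX, v, hv, rfl⟩
        exact hS X hX _ _ hp v (h2 hv)
      have := Submodule.finrank_lt_finrank_of_lt hlt
      omega
  refine ⟨Module.finrank ℂ E + 1, (key _).elim id fun h0 => ?_⟩
  have := hfin (Module.finrank ℂ E)
  exact Submodule.finrank_eq_zero.1 (by omega)

theorem finiteDimensional_range_of_mem_glInf {X : Module.End ℂ V} (hX : X ∈ glInf B) :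
    FiniteDimensional ℂ (LinearMap.range X) := by
  change X ∈ Submodule.span ℂ _ at hX
  induction hX using Submodule.span_induction with
  | mem X hX =>
    obtain ⟨v, w, rfl⟩ := hX
    have : LinearMap.range (rankOne B v w) ≤ Submodule.span ℂ {v} := by
      rintro _ ⟨x, rfl⟩
      exact Submodule.mem_span_singleton.2 ⟨_, rfl⟩
    exact Submodule.finiteDimensional_of_le this
  | zero => rw [LinearMap.range_zero]; infer_instance
  | add X Y _ _ hX hY =>
    have : LinearMap.range (X + Y) ≤ LinearMap.range X ⊔ LinearMap.range Y := by
      rintro _ ⟨x, rfl⟩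
      exact Submodule.add_mem_sup ⟨x, rfl⟩ ⟨x, rfl⟩
    exact Submodule.finiteDimensional_of_le this
  | smul c X _ hX =>
    have : LinearMap.range (c • X) ≤ LinearMap.range X := by
      rintro _ ⟨x, rfl⟩
      exact Submodule.smul_mem _ _ ⟨x, rfl⟩
    exact Submodule.finiteDimensional_of_le this

/-- A Lie algebra of operators that shifts a finite filtration is solvable. -/
theorem isSolvable_of_filtration {k : Type*} [LieRing k] [LieAlgebra ℂ k]
    (ρ : k →ₗ⁅ℂ⁆ Module.End ℂ V) (hρ : Function.Injective ρ) (W : ℕ → Submodule ℂ V)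
    (h0 : W 0 = ⊤) (hW : ∀ x i, ∀ v ∈ W i, ρ x v ∈ W (i + 1)) (n : ℕ) (hn : W n = ⊥) :
    LieAlgebra.IsSolvable k := by
  -- A linear shift suffices: in a bracket, one factor is only credited with a shift by 1.
  have key : ∀ m, ∀ x ∈ LieAlgebra.derivedSeries ℂ k m, ∀ i, ∀ v ∈ W i, ρ x v ∈ W (i + m + 1) := by
    intro m
    induction m with
    | zero => exact fun x _ i v hv => hW x i v hv
    | succ m ih =>
      intro x hx
      rw [LieAlgebra.derivedSeries_def, LieAlgebra.derivedSeriesOfIdeal_succ,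
        ← LieAlgebra.derivedSeries_def, ← LieSubmodule.mem_toSubmodule,
        LieSubmodule.lieIdeal_oper_eq_linear_span'] at hx
      induction hx using Submodule.span_induction with
      | mem x hx =>
        obtain ⟨y, hy, z, hz, rfl⟩ := hx
        intro i v hv
        rw [LieHom.map_lie, Ring.lie_def]
        refine Submodule.sub_mem _ ?_ ?_
        · exact hW y _ _ (ih z hz i v hv)
        · have := ih z hz _ _ (hW y i v hv)
          rwa [show i + 1 + m + 1 = i + (m + 1) + 1 by omega] at this
      | zero => intro i v _; simp
      | add x y _ _ hx hy =>
        intro i v hv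
        rw [map_add]
        exact Submodule.add_mem _ (hx i v hv) (hy i v hv)
      | smul c x _ hx =>
        intro i v hv
        rw [map_smul]
        exact Submodule.smul_mem _ _ (hx i v hv)
  rcases n with _ | n
  · refine (LieAlgebra.isSolvable_iff ℂ k).2 ⟨0, (LieSubmodule.eq_bot_iff _).2 fun x _ => ?_⟩
    apply hρ
    ext v
    have : v ∈ W 0 := h0 ▸ Submodule.mem_top
    rw [hn, Submodule.mem_bot] at this
    simp [this]
  · refine (LieAlgebra.isSolvable_iff ℂ k).2 ⟨n, (LieSubmodule.eq_bot_iff _).2 fun x hx => ?_⟩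
    apply hρ
    ext v
    have := key n x hx 0 v (h0 ▸ Submodule.mem_top)
    rw [zero_add, hn, Submodule.mem_bot] at this
    simp [this]

/-- The ideal of strictly lowering operators in a Lie algebra of operators stabilizing `𝓕`. -/
def loweringIdeal (g : LieSubalgebra ℂ (Module.End ℂ V)) (𝓕 : Set (Submodule ℂ V)) :
    LieIdeal ℂ (stabilizer g 𝓕) where
  carrier := {x | StrictlyLowers 𝓕 (x : Module.End ℂ V)}
  add_mem' hx hy F' F'' hp v hv := F'.add_mem (hx F' F'' hp v hv) (hy F' F'' hp v hv)
  zero_mem' F' _ _ _ _ := F'.zero_mem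
  smul_mem' c _ hx F' F'' hp v hv := F'.smul_mem c (hx F' F'' hp v hv)
  lie_mem {x _} hm F' F'' hp v hv := F'.sub_mem
    (x.2.2 F' hp.1 _ (hm F' F'' hp v hv)) (hm F' F'' hp _ (x.2.2 F'' hp.2.1 v hv))

/-- Finitely many finitary operators have their images in a common finite-dimensional `E`; the
lowering operators with image in `E` form a subalgebra whose iterated images reach zero. -/
theorem isLocallySolvable_loweringIdeal (h : IsGeneralizedFlag 𝓕)
    {g : LieSubalgebra ℂ (Module.End ℂ V)} (hg : g ≤ glInf B) :
    IsLocallySolvable (loweringIdeal g 𝓕) := by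
  intro s
  let op : loweringIdeal g 𝓕 → Module.End ℂ V := fun x => ((x : stabilizer g 𝓕) : Module.End ℂ V)
  let E : Submodule ℂ V := s.sup fun x => LinearMap.range (op x)
  have hfin : ∀ x : loweringIdeal g 𝓕, FiniteDimensional ℂ (LinearMap.range (op x)) :=
    fun x => finiteDimensional_range_of_mem_glInf (hg x.1.2.1)
  have hE : FiniteDimensional ℂ E := Submodule.finiteDimensional_finset_sup s _
  let k : LieSubalgebra ℂ (loweringIdeal g 𝓕) :=
    { carrier := {x | ∀ v, op x v ∈ E}
      add_mem' := fun hx hy v => E.add_mem (hx v) (hy v)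
      zero_mem' := fun _ => E.zero_mem
      smul_mem' := fun c _ hx v => E.smul_mem c (hx v)
      lie_mem' := fun hx hy v => E.sub_mem (hx _) (hy _) }
  refine ⟨k, fun x hx v => ?_, ?_⟩
  · have hle : LinearMap.range (op x) ≤ E := Finset.le_sup (f := fun x => LinearMap.range (op x)) hx
    exact hle ⟨v, rfl⟩
  let ρ : k →ₗ⁅ℂ⁆ Module.End ℂ V :=
    { toFun := fun x => op x
      map_add' := fun _ _ => rfl
      map_smul' := fun _ _ => rfl
      map_lie' := rfl }
  have hρ : Function.Injective ρ := fun x y hxy => Subtype.ext (Subtype.ext (Subtype.ext hxy))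
  obtain ⟨n, hn⟩ := h.exists_iteratedImage_eq_bot (S := Set.range ρ) (E := E)
    (by rintro _ ⟨x, rfl⟩; exact x.1.2) (by rintro _ ⟨x, rfl⟩; exact x.2)
  exact isSolvable_of_filtration ρ hρ (iteratedImage (Set.range ρ)) rfl
    (fun x i v hv => apply_mem_iteratedImage (Set.mem_range_self x) hv) n hn

theorem StrictlyLowers.isNilpotent (h : IsGeneralizedFlag 𝓕) {X : Module.End ℂ V}
    (hX : X ∈ glInf B) (hl : StrictlyLowers 𝓕 X) : IsNilpotent X := by
  have := finiteDimensional_range_of_mem_glInf hX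
  obtain ⟨n, hn⟩ := h.exists_iteratedImage_eq_bot (S := {X}) (E := LinearMap.range X)
    (by rintro _ rfl; exact hl) (by rintro _ rfl v; exact LinearMap.mem_range_self _ v)
  refine ⟨n, LinearMap.ext fun v => ?_⟩
  simpa [hn] using pow_apply_mem_iteratedImage X n v

theorem loweringIdeal_le_linearNilradical (h : IsGeneralizedFlag 𝓕)
    {g : LieSubalgebra ℂ (Module.End ℂ V)} (hg : g ≤ glInf B) :
    loweringIdeal g 𝓕 ≤ linearNilradical (stabilizer g 𝓕) := by
  intro x hx
  refine LieSubmodule.subset_lieSpan (Set.mem_ofPred.2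
    ⟨?_, StrictlyLowers.isNilpotent h (hg x.2.1) hx⟩)
  exact (le_sSup (isLocallySolvable_loweringIdeal h hg) :
    loweringIdeal g 𝓕 ≤ locallySolvableRadical (stabilizer g 𝓕)) hx

variable {p : LieSubalgebra ℂ (Module.End ℂ V)} {U : Submodule ℂ V}

theorem DefinedByInfiniteTraceConditions.lie_mem {g : LieSubalgebra ℂ (Module.End ℂ V)}
    (h : DefinedByInfiniteTraceConditions g p) {X Y : Module.End ℂ V} (hX : X ∈ g) (hY : Y ∈ g) :
    ⁅X, Y⁆ ∈ p := by
  obtain ⟨Tr, ⟨-, -, hTr⟩, -⟩ := h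
  refine (hTr ⁅(⟨X, hX⟩ : g), (⟨Y, hY⟩ : g)⁆).2 fun f _ => ?_
  rw [LieHom.map_lie, Ring.lie_def, mul_comm, sub_self]

/-- Subspaces stable under a subalgebra given by infinite trace conditions are weakly stable. -/
theorem DefinedByInfiniteTraceConditions.isWeaklyStable (h : IsGeneralizedFlag 𝓕)
    (hp : DefinedByInfiniteTraceConditions (stabilizer (soInf B) 𝓕) p)
    (hU : ∀ X ∈ p, ∀ u ∈ U, X u ∈ U) : IsWeaklyStable B 𝓕 U where
  lowering X hX hl := by
    obtain ⟨Tr, ⟨-, hm, -⟩, -⟩ := hp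
    exact hU X (hm ⟨X, hX⟩ (loweringIdeal_le_linearNilradical (B := B) h inf_le_left hl))
  lie _ hX _ hY := hU _ (hp.lie_mem hX hY)

theorem isWeaklyStable_of_stabilizer (hU : ∀ X ∈ stabilizer (soInf B) 𝓕, ∀ u ∈ U, X u ∈ U) :
    IsWeaklyStable B 𝓕 U where
  lowering X hX _ := hU X hX
  lie _ hX _ hY := hU _ (LieSubalgebra.lie_mem _ hX hY)

end Nilradical

/-! ### Comparison of all flags belonging to one subalgebra -/

section Classification

variable {V : Type*} [AddCommGroup V] [Module ℂ V] {𝓕 𝓖 : Set (Submodule ℂ V)}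
  {B : LinearMap.BilinForm ℂ V} {L L' : Submodule ℂ V} {a b : V}
  {p : LieSubalgebra ℂ (Module.End ℂ V)}

theorem soInf_apply_orth {X : Module.End ℂ V} (hX : X ∈ soInf B) (x y : V) :
    B (X x) y = -B x (X y) :=
  hX.2 x y

/-- Skewness gives ⟨Xa, a⟩ = 0 and keeps `Xa` in `Lᗮ`, and `L + ℂa` consists of the vectors of `Lᗮ`
orthogonal to `a`. -/
theorem IsHyperbolicPair.sup_stable (hB : B.IsSymm) (h : IsHyperbolicPair B L a b)
    (hL : IsIsotropic B L) {X : Module.End ℂ V} (hX : X ∈ soInf B) (hXL : ∀ v ∈ L, X v ∈ L) :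
    ∀ v ∈ L ⊔ Submodule.span ℂ {a}, X v ∈ L ⊔ Submodule.span ℂ {a} := by
  have hXa : X a ∈ L ⊔ Submodule.span ℂ {a} := by
    refine (h.mem_sup_iff hL).2 ⟨(mem_orth' hB).2 fun y hy => ?_, ?_⟩
    · rw [soInf_apply_orth hX, (mem_orth' hB).1 h.left_mem _ (hXL y hy), neg_zero]
    · have h1 := soInf_apply_orth hX a a
      rw [hB.eq a (X a)] at h1
      linear_combination h1 / 2
  intro v hv
  obtain ⟨c, hc⟩ := mem_sup_span_singleton_iff.1 hv
  have := Submodule.add_mem _ (Submodule.mem_sup_left (T := Submodule.span ℂ {a}) (hXL _ hc))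
    (Submodule.smul_mem _ c hXa)
  simpa using this

theorem stabilizer_anti {g : LieSubalgebra ℂ (Module.End ℂ V)} (h : 𝓕 ⊆ 𝓖) :
    stabilizer g 𝓖 ≤ stabilizer g 𝓕 :=
  fun _ hX => ⟨hX.1, fun F hF => hX.2 F (h hF)⟩

theorem definedByInfiniteTraceConditions_self (g : LieSubalgebra ℂ (Module.End ℂ V)) :
    DefinedByInfiniteTraceConditions g g :=
  ⟨∅, ⟨le_rfl, fun x _ => x.2, fun x => by simp⟩, by simp⟩

theorem DefinedByInfiniteTraceConditions.le {g : LieSubalgebra ℂ (Module.End ℂ V)}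
    (h : DefinedByInfiniteTraceConditions g p) : p ≤ g := by
  obtain ⟨_, ⟨hle, -, -⟩, -⟩ := h
  exact hle

theorem DefinedByInfiniteTraceConditions.isWeaklyStable_of_mem (h𝓕 : IsGeneralizedFlag 𝓕)
    (hp𝓕 : DefinedByInfiniteTraceConditions (stabilizer (soInf B) 𝓕) p)
    (hp𝓖 : DefinedByInfiniteTraceConditions (stabilizer (soInf B) 𝓖) p) {G : Submodule ℂ V}
    (hG : G ∈ 𝓖) : IsWeaklyStable B 𝓕 G :=
  hp𝓕.isWeaklyStable h𝓕 fun _ hX => (hp𝓖.le hX).2 G hG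

theorem IsHyperbolicPair.closure_sup (hB : B.IsSymm) (h : IsHyperbolicPair B L a b)
    (hL : IsIsotropic B L) :
    mackeyClosure B (L ⊔ Submodule.span ℂ {a}) = L ⊔ Submodule.span ℂ {a} := by
  rw [mackeyClosure, h.orth_sup hB hL, h.orth_sup hB hL]

/-- Being exceptional is shared by all flags belonging to the same subalgebra `p`. -/
theorem exists_isExceptional_of_isExceptional (hB : B.IsSymm) (h𝓕 : IsSelfTaut B 𝓕)
    (hp𝓕 : DefinedByInfiniteTraceConditions (stabilizer (soInf B) 𝓕) p)
    (hp𝓖 : DefinedByInfiniteTraceConditions (stabilizer (soInf B) 𝓖) p)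
    (hL : IsExceptional B 𝓖 L) : ∃ K, IsExceptional B 𝓕 K := by
  by_contra hn
  obtain ⟨a, b, h⟩ := hL.exists_hyperbolic hB
  have hw : ∀ {a b : V}, IsHyperbolicPair B L a b →
      IsWeaklyStable B 𝓕 (L ⊔ Submodule.span ℂ {a}) := fun h =>
    hp𝓕.isWeaklyStable h𝓕.toIsGeneralizedFlag fun X hX =>
      h.sup_stable hB hL.2.1 (hp𝓖.le hX).1 ((hp𝓖.le hX).2 L hL.1)
  obtain ⟨K, hK, -⟩ := exists_isExceptional_le hB h𝓕 (fun K hK => absurd ⟨K, hK⟩ hn) (hw h)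
    (hw h.symm) (h.closure_sup hB hL.2.1) (h.sup_not_le hL.2.1) (h.symm.sup_not_le hL.2.1)
  exact hn ⟨K, hK⟩

theorem eq_of_not_isExceptional (hB : B.IsSymm) (h𝓕 : IsSelfTaut B 𝓕) (h𝓖 : IsSelfTaut B 𝓖)
    (hp𝓕 : DefinedByInfiniteTraceConditions (stabilizer (soInf B) 𝓕) p)
    (hp𝓖 : DefinedByInfiniteTraceConditions (stabilizer (soInf B) 𝓖) p)
    (hn : ¬ ∃ K, IsExceptional B 𝓕 K) : 𝓖 = 𝓕 := by
  have hn' : ¬ ∃ K, IsExceptional B 𝓖 K := fun ⟨K, hK⟩ =>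
    hn (exists_isExceptional_of_isExceptional hB h𝓕 hp𝓕 hp𝓖 hK)
  refine eq_of_isNearCut hB h𝓖.toIsSemiclosed h𝓕.toIsSemiclosed (fun G hG => ?_) fun F hF => ?_
  · exact (hp𝓕.isWeaklyStable_of_mem h𝓕.toIsGeneralizedFlag hp𝓖 hG).isNearCut hB h𝓕
      (fun K hK => absurd ⟨K, hK⟩ hn) fun K hK => absurd ⟨K, hK⟩ hn
  · exact (hp𝓖.isWeaklyStable_of_mem h𝓖.toIsGeneralizedFlag hp𝓕 hF).isNearCut hB h𝓖
      (fun K hK => absurd ⟨K, hK⟩ hn') fun K hK => absurd ⟨K, hK⟩ hn'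

theorem IsHyperbolicPair.orth_mem_truncation (hB : B.IsSymm) (h : IsHyperbolicPair B L a b)
    (h𝓕 : IsSelfTaut B 𝓕) (hL : IsExceptional B 𝓕 L) :
    B.orthogonal L ∈ truncation B 𝓕 L :=
  ⟨h.orth_mem hB hL.2.1 h𝓕 hL.1, .inr le_rfl⟩

theorem IsHyperbolicPair.isSelfTaut_truncation_union (hB : B.IsSymm)
    (h : IsHyperbolicPair B L a b) (h𝓕 : IsSelfTaut B 𝓕) (hL : IsExceptional B 𝓕 L) :
    IsSelfTaut B (truncation B 𝓕 L) ∧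
      IsSelfTaut B (truncation B 𝓕 L ∪ {L ⊔ Submodule.span ℂ {a}}) := by
  have hL' := h.orth_mem hB hL.2.1 h𝓕 hL.1
  have hlt := h.lt_sup.trans (h.sup_lt hL.2.1)
  constructor
  · rw [← Set.union_empty (truncation B 𝓕 L)]
    exact h𝓕.truncation_union hB hL.1 hL' hL.2.2.1 hlt Set.subsingleton_empty (by simp)
  · refine h𝓕.truncation_union hB hL.1 hL' hL.2.2.1 hlt Set.subsingleton_singleton ?_
    rintro _ rfl
    exact ⟨h.lt_sup, h.sup_lt hL.2.1, h.orth_sup hB hL.2.1⟩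

theorem IsExceptional.of_truncation {K : Submodule ℂ V}
    (hK : IsExceptional B (truncation B 𝓕 L) K) : IsExceptional B 𝓕 K :=
  ⟨hK.1.1, hK.2⟩

theorem IsExceptional.isReduced_truncation (hB : B.IsSymm) (h𝓕 : IsSelfTaut B 𝓕)
    (hL : IsExceptional B 𝓕 L) : IsReduced B (truncation B 𝓕 L) := by
  obtain ⟨a, b, h⟩ := hL.exists_hyperbolic hB
  intro K hK
  obtain rfl := hL.eq hB h𝓕.chain hK.of_truncation
  refine ⟨hK.1, h.orth_mem_truncation hB h𝓕 hL, h.lt_sup.trans (h.sup_lt hL.2.1), ?_⟩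
  rintro G ⟨-, h1 | h1⟩ ⟨h2, h3⟩
  · exact h2.not_ge h1
  · exact h3.not_ge h1

theorem IsHyperbolicPair.flag_cases (hB : B.IsSymm) (h : IsHyperbolicPair B L a b)
    (h𝓕 : IsSelfTaut B 𝓕) (hL : IsExceptional B 𝓕 L) :
    𝓕 = truncation B 𝓕 L ∨ 𝓕 = truncation B 𝓕 L ∪ {L ⊔ Submodule.span ℂ {a}} ∨
      𝓕 = truncation B 𝓕 L ∪ {L ⊔ Submodule.span ℂ {b}} := by
  have hc := h𝓕.chain
  have hL' := h.orth_mem hB hL.2.1 h𝓕 hL.1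
  have hmem : ∀ F ∈ 𝓕, F ∈ truncation B 𝓕 L ∨ F = L ⊔ Submodule.span ℂ {a} ∨
      F = L ⊔ Submodule.span ℂ {b} := by
    intro F hF
    by_cases h1 : F ≤ L
    · exact .inl ⟨hF, .inl h1⟩
    by_cases h2 : B.orthogonal L ≤ F
    · exact .inl ⟨hF, .inr h2⟩
    exact .inr (h.eq_of_lt_of_lt hB hL.2.1 h𝓕 hF
      (((hc.total hF hL.1).resolve_left h1).lt_of_not_ge h1)
      (((hc.total hF hL').resolve_right h2).lt_of_not_ge h2))
  have hsub : truncation B 𝓕 L ⊆ 𝓕 := fun F hF => hF.1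
  have key : ∀ {a b : V}, IsHyperbolicPair B L a b → (∀ F ∈ 𝓕, F ∈ truncation B 𝓕 L ∨
      F = L ⊔ Submodule.span ℂ {a} ∨ F = L ⊔ Submodule.span ℂ {b}) →
      L ⊔ Submodule.span ℂ {a} ∈ 𝓕 →
      𝓕 = truncation B 𝓕 L ∪ {L ⊔ Submodule.span ℂ {a}} := by
    intro a b h hmem ha
    refine Set.Subset.antisymm (fun F hF => ?_)
      (Set.union_subset hsub (Set.singleton_subset_iff.2 ha))
    rcases hmem F hF with h1 | h1 | h1
    · exact .inl h1
    · exact .inr h1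
    · rcases hc.total ha hF with h2 | h2
      · exact absurd (h1 ▸ h2) (h.sup_not_le hL.2.1)
      · exact absurd (h1 ▸ h2) (h.symm.sup_not_le hL.2.1)
  by_cases ha : L ⊔ Submodule.span ℂ {a} ∈ 𝓕
  · exact .inr (.inl (key h hmem ha))
  by_cases hb : L ⊔ Submodule.span ℂ {b} ∈ 𝓕
  · exact .inr (.inr (key h.symm (fun F hF => (hmem F hF).imp id Or.symm) hb))
  refine .inl (Set.Subset.antisymm (fun F hF => ?_) hsub)
  rcases hmem F hF with h1 | h1 | h1
  · exact h1
  · exact absurd (h1 ▸ hF) ha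
  · exact absurd (h1 ▸ hF) hb

theorem IsHyperbolicPair.stabilizer_union (hB : B.IsSymm) (h : IsHyperbolicPair B L a b)
    (hL : IsExceptional B 𝓕 L) :
    stabilizer (soInf B) (truncation B 𝓕 L ∪ {L ⊔ Submodule.span ℂ {a}}) =
      stabilizer (soInf B) (truncation B 𝓕 L) := by
  refine le_antisymm (stabilizer_anti Set.subset_union_left) fun X hX => ⟨hX.1, ?_⟩
  rintro F (hF | rfl)
  · exact hX.2 F hF
  · exact h.sup_stable hB hL.2.1 hX.1 (hX.2 L ⟨hL.1, .inl le_rfl⟩)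

theorem IsHyperbolicPair.stabilizer_truncation (hB : B.IsSymm) (h : IsHyperbolicPair B L a b)
    (h𝓕 : IsSelfTaut B 𝓕) (hL : IsExceptional B 𝓕 L) :
    stabilizer (soInf B) (truncation B 𝓕 L) = stabilizer (soInf B) 𝓕 := by
  rcases h.flag_cases hB h𝓕 hL with h1 | h1 | h1
  · rw [← h1]
  · rw [← h.stabilizer_union hB hL, ← h1]
  · rw [← h.symm.stabilizer_union hB hL, ← h1]

/-- Two exceptional self-taut flags with the same stabilizer have comparable exceptional members. -/
theorem IsExceptional.le_of_stabilizer_eq (hB : B.IsSymm) (h𝓖 : IsSelfTaut B 𝓖)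
    (hst : stabilizer (soInf B) 𝓖 = stabilizer (soInf B) 𝓕) (hL : IsExceptional B 𝓕 L)
    (hL' : IsExceptional B 𝓖 L') : L' ≤ L := by
  obtain ⟨a, b, h⟩ := hL.exists_hyperbolic hB
  obtain ⟨c, d, h'⟩ := hL'.exists_hyperbolic hB
  have hw : ∀ {a b : V}, IsHyperbolicPair B L a b →
      IsWeaklyStable B (truncation B 𝓖 L') (L ⊔ Submodule.span ℂ {a}) := fun h =>
    isWeaklyStable_of_stabilizer fun X hX => by
      rw [h'.stabilizer_truncation hB h𝓖 hL', hst] at hX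
      exact h.sup_stable hB hL.2.1 hX.1 (hX.2 L hL.1)
  obtain ⟨K, hK, hKa, hKb⟩ := exists_isExceptional_le hB
    (h'.isSelfTaut_truncation_union hB h𝓖 hL').1 (hL'.isReduced_truncation hB h𝓖) (hw h)
    (hw h.symm) (h.closure_sup hB hL.2.1) (h.sup_not_le hL.2.1) (h.symm.sup_not_le hL.2.1)
  obtain rfl := hL'.eq hB h𝓖.chain hK.of_truncation
  -- The two Lagrangian subspaces over `L` meet in `L`.
  intro x hx
  obtain ⟨h1, h2⟩ := (h.mem_sup_iff hL.2.1).1 (hKa hx)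
  simpa [h2, ((h.symm.mem_sup_iff hL.2.1).1 (hKb hx)).2] using h.sub_mem x h1

theorem IsExceptional.isNearCut_truncation (hB : B.IsSymm) (h𝓕 : IsSelfTaut B 𝓕)
    (hst : stabilizer (soInf B) 𝓖 = stabilizer (soInf B) 𝓕) (hL : IsExceptional B 𝓕 L) :
    ∀ G ∈ truncation B 𝓖 L, IsNearCut B (truncation B 𝓕 L) G := by
  obtain ⟨a, b, h⟩ := hL.exists_hyperbolic hB
  intro G hG
  have hw : IsWeaklyStable B (truncation B 𝓕 L) G := isWeaklyStable_of_stabilizer fun X hX => by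
    rw [h.stabilizer_truncation hB h𝓕 hL, ← hst] at hX
    exact hX.2 G hG.1
  refine hw.isNearCut hB (h.isSelfTaut_truncation_union hB h𝓕 hL).1
    (hL.isReduced_truncation hB h𝓕) fun K hK => ?_
  obtain rfl := hL.eq hB h𝓕.chain hK.of_truncation
  exact hG.2

theorem IsHyperbolicPair.flagsWithSameStabilizer_eq (hB : B.IsSymm)
    (h : IsHyperbolicPair B L a b) (h𝓕 : IsSelfTaut B 𝓕) (hL : IsExceptional B 𝓕 L) :
    flagsWithSameStabilizer B 𝓕 = {truncation B 𝓕 L,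
      truncation B 𝓕 L ∪ {L ⊔ Submodule.span ℂ {a}},
      truncation B 𝓕 L ∪ {L ⊔ Submodule.span ℂ {b}}} := by
  have hT := h.stabilizer_truncation hB h𝓕 hL
  ext 𝓖
  simp only [Set.mem_insert_iff, Set.mem_singleton_iff]
  constructor
  · rintro ⟨h𝓖, hst⟩
    -- The common stabilizer, with the empty family of conditions, plays the role of `p`.
    have hself := definedByInfiniteTraceConditions_self (stabilizer (soInf B) 𝓕)
    obtain ⟨L', hL'⟩ := exists_isExceptional_of_isExceptional hB h𝓖 (hst ▸ hself) hself hL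
    obtain rfl : L' = L := le_antisymm (hL.le_of_stabilizer_eq hB h𝓖 hst hL')
      (hL'.le_of_stabilizer_eq hB h𝓕 hst.symm hL)
    have hTT : truncation B 𝓕 L' = truncation B 𝓖 L' := eq_of_isNearCut hB
      (h.isSelfTaut_truncation_union hB h𝓕 hL).1.toIsSemiclosed
      (h.isSelfTaut_truncation_union hB h𝓖 hL').1.toIsSemiclosed
      (hL'.isNearCut_truncation hB h𝓖 hst.symm) (hL.isNearCut_truncation hB h𝓕 hst)
    rw [hTT]
    exact h.flag_cases hB h𝓖 hL'
  · rintro (rfl | rfl | rfl)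
    · exact ⟨(h.isSelfTaut_truncation_union hB h𝓕 hL).1, hT⟩
    · exact ⟨(h.isSelfTaut_truncation_union hB h𝓕 hL).2, (h.stabilizer_union hB hL).trans hT⟩
    · exact ⟨(h.symm.isSelfTaut_truncation_union hB h𝓕 hL).2,
        (h.symm.stabilizer_union hB hL).trans hT⟩

theorem IsHyperbolicPair.ncard_flagsWithSameStabilizer (hB : B.IsSymm)
    (h : IsHyperbolicPair B L a b) (h𝓕 : IsSelfTaut B 𝓕) (hL : IsExceptional B 𝓕 L) :
    (flagsWithSameStabilizer B 𝓕).ncard = 3 := by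
  have hnot : ∀ {a b : V}, IsHyperbolicPair B L a b →
      L ⊔ Submodule.span ℂ {a} ∉ truncation B 𝓕 L := fun h hn =>
    hn.2.elim h.lt_sup.not_ge (h.sup_lt hL.2.1).not_ge
  refine Set.ncard_eq_three.2 ⟨_, _, _, ?_, ?_, ?_, h.flagsWithSameStabilizer_eq hB h𝓕 hL⟩
  · exact fun he => hnot h (he ▸ .inr rfl)
  · exact fun he => hnot h.symm (he ▸ .inr rfl)
  · intro he
    have hmem : L ⊔ Submodule.span ℂ {a} ∈ truncation B 𝓕 L ∪ {L ⊔ Submodule.span ℂ {b}} :=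
      he ▸ .inr rfl
    rcases hmem with h1 | h1
    · exact hnot h h1
    · exact h.sup_not_le hL.2.1 (le_of_eq h1)

theorem flagsWithSameStabilizer_subset_flagsOf
    (hp : DefinedByInfiniteTraceConditions (stabilizer (soInf B) 𝓕) p) :
    flagsWithSameStabilizer B 𝓕 ⊆ flagsOf B p :=
  fun _ h𝓖 => ⟨h𝓖.1, h𝓖.2 ▸ hp⟩

theorem flagsOf_eq_singleton (hB : B.IsSymm) (h𝓕 : IsSelfTaut B 𝓕)
    (hp : DefinedByInfiniteTraceConditions (stabilizer (soInf B) 𝓕) p)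
    (hn : ¬ ∃ L, IsExceptional B 𝓕 L) : flagsOf B p = {𝓕} :=
  Set.eq_singleton_iff_unique_mem.2
    ⟨⟨h𝓕, hp⟩, fun _ h𝓖 => eq_of_not_isExceptional hB h𝓕 h𝓖.1 hp h𝓖.2 hn⟩

theorem flagsOf_ne_singleton
    (hp : DefinedByInfiniteTraceConditions (stabilizer (soInf B) 𝓕) p)
    (h3 : (flagsWithSameStabilizer B 𝓕).ncard = 3) : flagsOf B p ≠ {𝓕} := by
  intro he
  have := Set.ncard_le_ncard (he ▸ flagsWithSameStabilizer_subset_flagsOf hp)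
    (Set.finite_singleton 𝓕)
  rw [h3, Set.ncard_singleton] at this
  omega

end Classification

end FinitaryFlags

/-! ### The dichotomy between one flag and three -/

theorem mainTheorem2 {V : Type*} [AddCommGroup V] [Module ℂ V]
    (hV : Module.rank ℂ V = Cardinal.aleph0)
    (B : LinearMap.BilinForm ℂ V) (hsymm : B.IsSymm) (hnondeg : B.Nondegenerate)
    (𝓕 : Set (Submodule ℂ V)) (h𝓕 : FinitaryFlags.IsSelfTaut B 𝓕)
    (p : LieSubalgebra ℂ (Module.End ℂ V))
    (hp : FinitaryFlags.IsParabolic (FinitaryFlags.soInf B) p)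
    (hp𝓕 : FinitaryFlags.DefinedByInfiniteTraceConditions
      (FinitaryFlags.stabilizer (FinitaryFlags.soInf B) 𝓕) p) :
    Xor (FinitaryFlags.flagsOf B p = {𝓕})
      ((FinitaryFlags.flagsWithSameStabilizer B 𝓕).ncard = 3) ∧
    ((FinitaryFlags.flagsWithSameStabilizer B 𝓕).ncard = 3 ↔
      ∃ L, FinitaryFlags.IsExceptional B 𝓕 L) ∧
    ∀ L, FinitaryFlags.IsExceptional B 𝓕 L →
      ∃ M₁ M₂ : Submodule ℂ V, M₁ ≠ M₂ ∧
        {N | Maximal (FinitaryFlags.IsIsotropic B) N ∧ L ≤ N} = {M₁, M₂} ∧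
        FinitaryFlags.flagsWithSameStabilizer B 𝓕 =
          {FinitaryFlags.truncation B 𝓕 L,
            FinitaryFlags.truncation B 𝓕 L ∪ {M₁},
            FinitaryFlags.truncation B 𝓕 L ∪ {M₂}} := by
  have hiff : (FinitaryFlags.flagsWithSameStabilizer B 𝓕).ncard = 3 ↔
      ∃ L, FinitaryFlags.IsExceptional B 𝓕 L := by
    constructor
    · intro h3
      by_contra hn
      exact FinitaryFlags.flagsOf_ne_singleton hp𝓕 h3
        (FinitaryFlags.flagsOf_eq_singleton hsymm h𝓕 hp𝓕 hn)
    · rintro ⟨L, hL⟩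
      obtain ⟨a, b, h⟩ := hL.exists_hyperbolic hsymm
      exact h.ncard_flagsWithSameStabilizer hsymm h𝓕 hL
  refine ⟨?_, hiff, fun L hL => ?_⟩
  · by_cases h3 : (FinitaryFlags.flagsWithSameStabilizer B 𝓕).ncard = 3
    · exact .inr ⟨h3, FinitaryFlags.flagsOf_ne_singleton hp𝓕 h3⟩
    · exact .inl ⟨FinitaryFlags.flagsOf_eq_singleton hsymm h𝓕 hp𝓕 (hiff.not.1 h3), h3⟩
  · obtain ⟨a, b, h⟩ := hL.exists_hyperbolic hsymm
    exact ⟨_, _, fun he => h.sup_not_le hL.2.1 he.le, h.maximal_isotropic_eq hsymm hL.2.1,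
      h.flagsWithSameStabilizer_eq hsymm h𝓕 hL⟩
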